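/- Let $n\ge 1$ and $T>0$, write $|x|=\sum_{i=1}^n|x_i|$ for $x\in\mathbb R^n$ and $\mathbb R_+^n=[0,\infty)^n$. For $i=1,\dots,n$ let $a_i,g_i,e_i:\mathbb R\to\mathbb R$ be continuous and $T$-periodic with $a_i(t)\ge 0$, $g_i(t)\ge 0$, $e_i(t)\ge 0$ for $t\in[0,T]$ and $\int_0^T g_i(t)\,dt>0$. Let $f_i:\mathbb R_+^n\setminus\{0\}\to(0,\infty)$ be continuous with $\lim_{x\to 0}f_i(x)=\infty$, for every $i$. Assume that for every $i$ the problem $$x''+a_i(t)x=h(t),\qquad x(0)=x(T),\quad x'(0)=x'(T)$$ has a Green function $G_i$ (that is, $G_i$ is continuous on $[0,T]\times[0,T]$ and, for every continuous $T$-periodic $h$, the unique solution of the problem on $[0,T]$ is $x(t)=\int_0^T G_i(t,s)h(s)\,ds$), and that $G_i(t,s)>0$ for all $(t,s)\in[0,T]\times[0,T]$. For $\lambda>0$ consider the system $$x_i''+a_i(t)x_i=\lambda g_i(t)f_i(x)+\lambda e_i(t),\qquad i=1,\dots,n. \tag{$*$}$$ A positive $T$-periodic solution of $(*)$ is a $T$-periodic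 function $x\in C^2(\mathbb R,\mathbb R^n)$ that satisfies $(*)$ and has $x_i(t)>0$ for all $t\in\mathbb R$ and all $i$. All limits of the $f_i$ are taken within $\mathbb R_+^n\setminus\{0\}$. Then: (a) If $\lim_{|x|\to\infty}f_i(x)/|x|=0$ for every $i$, then $(*)$ has a positive $T$-periodic solution for every $\lambda>0$. (b) If $\lim_{|x|\to\infty}f_i(x)/|x|=\infty$ for every $i$, then there is $\lambda_0>0$ such that for every $\lambda\in(0,\lambda_0)$ the system $(*)$ has two distinct positive $T$-periodic solutions. (c) There is $\lambda_0>0$ such that for every $\lambda\in(0,\lambda_0)$ the system $(*)$ has a positive $T$-periodic solution. -/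

import Mathlib

open Set Filter Topology

/-- The norm `|x| = ∑ |x_i|` on `ℝⁿ`. -/
def sumNorm {n : ℕ} (x : Fin n → ℝ) : ℝ := ∑ i, |x i|

/-- The punctured nonnegative orthant `ℝ₊ⁿ \ {0}`. -/
def puncturedOrthant (n : ℕ) : Set (Fin n → ℝ) := {x | (∀ i, 0 ≤ x i) ∧ 0 < sumNorm x}

/-- The filter on `ℝⁿ` describing `x → 0` with `x ∈ ℝ₊ⁿ \ {0}`. -/
def orthantZero (n : ℕ) : Filter (Fin n → ℝ) := 𝓝[puncturedOrthant n] 0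

/-- The filter on `ℝⁿ` describing `|x| → ∞` with `x ∈ ℝ₊ⁿ \ {0}`. -/
def orthantInfty (n : ℕ) : Filter (Fin n → ℝ) :=
  comap sumNorm atTop ⊓ 𝓟 (puncturedOrthant n)

/-- `x` solves, on `[0, T]`, the scalar periodic boundary value problem
`x'' + a(t) x = h(t)`, `x(0) = x(T)`, `x'(0) = x'(T)`; the function `y` is `x'`
(one-sided derivatives at the end points). -/
def SolvesPeriodicBVP (T : ℝ) (a h x : ℝ → ℝ) : Prop :=
  ∃ y : ℝ → ℝ,
    (∀ t ∈ Icc 0 T, HasDerivWithinAt x (y t) (Icc 0 T) t) ∧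
    (∀ t ∈ Icc 0 T, HasDerivWithinAt y (h t - a t * x t) (Icc 0 T) t) ∧
    x 0 = x T ∧ y 0 = y T

/-- `G` is the Green function of the problem `x'' + a(t) x = h(t)`, `x(0) = x(T)`,
`x'(0) = x'(T)`: the continuous kernel on `[0, T] × [0, T]` such that, for every continuous
`T`-periodic `h`, the problem has exactly one solution on `[0, T]`, namely
`t ↦ ∫₀ᵀ G(t, s) h(s) ds`. -/
structure IsGreenFunction (T : ℝ) (a : ℝ → ℝ) (G : ℝ → ℝ → ℝ) : Prop where
  continuousOn : ContinuousOn (fun p : ℝ × ℝ => G p.1 p.2) (Icc 0 T ×ˢ Icc 0 T)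
  solves : ∀ h : ℝ → ℝ, Continuous h → Function.Periodic h T →
    SolvesPeriodicBVP T a h (fun t => ∫ s in (0 : ℝ)..T, G t s * h s)
  unique : ∀ h x : ℝ → ℝ, Continuous h → Function.Periodic h T →
    SolvesPeriodicBVP T a h x →
    ∀ t ∈ Icc 0 T, x t = ∫ s in (0 : ℝ)..T, G t s * h s

/-- `x : ℝ → ℝⁿ` is a positive `T`-periodic (classical, `C²`) solution of
`x_i'' + a_i(t) x_i = lam g_i(t) f_i(x) + lam e_i(t)`, `i = 1, …, n`. -/
structure IsPositivePeriodicSolution {n : ℕ} (T : ℝ) (a g e : Fin n → ℝ → ℝ)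
    (f : Fin n → (Fin n → ℝ) → ℝ) (lam : ℝ) (x : ℝ → Fin n → ℝ) : Prop where
  contDiff : ContDiff ℝ 2 x
  periodic : Function.Periodic x T
  pos : ∀ t i, 0 < x t i
  equation : ∀ t i, iteratedDeriv 2 (fun s => x s i) t + a i t * x t i =
    lam * g i t * f i (x t) + lam * e i t

/-!
# Positive periodic solutions of singular systems with a parameter

A positive periodic solution is a fixed point of the Hammerstein operator
`(Φ x)_i(t) = ∫₀ᵀ G_i(t, s) (λ g_i(s) f_i(x(s)) + λ e_i(s)) ds`, for the Green functions turn
the differential system into `x = Φ x` (`isPositivePeriodicSolution_of_integral_eq`). If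
`0 < m ≤ G_i ≤ M`, then `Φ` maps into the cone of functions with `m x_i(s) ≤ M x_i(t)`. For `x` in
this cone, `|x(t)|` lies between `(m / M) α(x)` and `(M / m) α(x)`, where `α(x) = ∑ x_i(0)`, so that
bounds on `f_i` on an annulus of `ℝ₊ⁿ` become bounds on `α(Φ x)` at a given level of `α`.

Since `f_i → ∞` at the origin, `Φ` raises low levels of `α`, for every `λ > 0`. At the level `1` it
lowers `α` when `λ` is small. At high levels it lowers `α` if `f_i` is sublinear at infinity, and
raises it if `f_i` is superlinear. Between a level that is raised and one that is lowered there is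
a fixed point (`exists_isPositivePeriodicSolution`); in the superlinear case with small `λ` there is
one below the level `1` and one above it.

The fixed point theorem behind this is Krasnoselskii's compression-expansion theorem
(`exists_fixedPoint_of_cone`). As `α` is linear, the shell between two of its levels is convex, and
both the compressive and the expansive case follow from Schauder's theorem applied to a rescaling of
`Φ`. Schauder's theorem (`exists_fixedPoint_of_mapsTo_compact`) is reduced to Brouwer's theorem on
a simplex, which rests on the absence of a `C¹` retraction of the ball onto the sphere
(`not_exists_contDiff_retraction`), proved by the change of variables formula following Milnor and
Rogers.
-/

/-! ### No `C¹` retraction of the ball onto the sphere -/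

section Brouwer

open MeasureTheory

open scoped NNReal

variable {E : Type*} [NormedAddCommGroup E] [InnerProductSpace ℝ E] [FiniteDimensional ℝ E]

theorem exists_polynomial_eval_eq_det_one_add_smul (A : E →L[ℝ] E) :
    ∃ p : Polynomial ℝ, p.natDegree ≤ Module.finrank ℝ E ∧
      ∀ t : ℝ, p.eval t = (1 + t • A).det := by
  classical
  let b := Module.finBasis ℝ E
  let M := LinearMap.toMatrix b b (A : E →ₗ[ℝ] E)
  refine ⟨Matrix.det ((Polynomial.X : Polynomial ℝ) • M.map Polynomial.C +
    (1 : Matrix _ _ ℝ).map Polynomial.C), ?_, fun t => ?_⟩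
  · simpa using Polynomial.natDegree_det_X_add_C_le M 1
  · rw [ContinuousLinearMap.det, ← LinearMap.det_toMatrix b, ← Polynomial.coe_evalRingHom,
      RingHom.map_det]
    congr 1
    ext i j
    simp [M, LinearMap.toMatrix_apply, Matrix.one_apply, Finsupp.single_apply, apply_ite, eq_comm,
      add_comm]
    ring

variable [MeasurableSpace E] [BorelSpace E]

/-- For each `x`, `t ↦ det (1 + t A(x))` is a polynomial of bounded degree, so its value at `1` is a
fixed linear combination (Lagrange interpolation) of its values at nodes in `(0, ε)`. Hence
constancy of the integral for small `t` persists up to `t = 1`. -/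
theorem integral_det_one_add_eq {B : Set E} (hB : IsCompact B) {A : E → E →L[ℝ] E}
    (hA : ContinuousOn A B) {ε c : ℝ} (hε : 0 < ε)
    (hc : ∀ t ∈ Ioo 0 ε, ∫ x in B, (1 + t • A x).det = c) :
    ∫ x in B, (1 + A x).det = c := by
  classical
  let d := Module.finrank ℝ E
  let v : Fin (d + 1) → ℝ := fun j => ε / (j + 2)
  have hv : InjOn v (Finset.univ : Finset (Fin (d + 1))) := by
    intro i _ j _ hij
    have h1 : (0 : ℝ) < (i : ℕ) + 2 := by positivity
    have h2 : (0 : ℝ) < (j : ℕ) + 2 := by positivity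
    simp only [v] at hij
    rw [div_eq_div_iff h1.ne' h2.ne'] at hij
    have := mul_left_cancel₀ hε.ne' hij
    exact Fin.ext (by exact_mod_cast (by linarith : ((i : ℕ) : ℝ) = (j : ℕ)))
  have hvm : ∀ j, v j ∈ Ioo 0 ε := fun j =>
    ⟨by positivity, by
      rw [div_lt_iff₀ (by positivity)]
      nlinarith [(by positivity : (0 : ℝ) ≤ (j : ℕ))]⟩
  have hint : ∀ j, Integrable (fun x => (1 + v j • A x).det) (volume.restrict B) := fun j =>
    ContinuousOn.integrableOn_compact hB
      (ContinuousLinearMap.continuous_det.comp_continuousOn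
        (continuousOn_const.add (hA.const_smul (v j))))
  let l : Fin (d + 1) → ℝ := fun j => (Lagrange.basis Finset.univ v j).eval 1
  have hl : ∑ j, l j = 1 := by
    rw [← Polynomial.eval_finsetSum, Lagrange.sum_basis hv Finset.univ_nonempty,
      Polynomial.eval_one]
  have key : ∀ x, (1 + A x).det = ∑ j, (1 + v j • A x).det * l j := by
    intro x
    obtain ⟨p, hp, hpe⟩ := exists_polynomial_eval_eq_det_one_add_smul (A x)
    have hdeg : p.degree < (Finset.univ : Finset (Fin (d + 1))).card := by
      refine lt_of_le_of_lt Polynomial.degree_le_natDegree ?_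
      simp only [Finset.card_univ, Fintype.card_fin]
      exact_mod_cast Nat.lt_succ_of_le hp
    have h := congrArg (Polynomial.eval 1) (Lagrange.eq_interpolate hv hdeg)
    rw [hpe, one_smul, Lagrange.interpolate_apply, Polynomial.eval_finsetSum] at h
    simpa [hpe, l] using h
  simp_rw [key]
  rw [integral_finsetSum _ fun j _ => (hint j).mul_const _]
  simp_rw [integral_mul_const, hc _ (hvm _), ← Finset.mul_sum, hl, mul_one]

omit [FiniteDimensional ℝ E] [MeasurableSpace E] [BorelSpace E] in
/-- If `g` is Lipschitz on the unit ball and vanishes on the sphere, then `x ↦ x + t g(x)` maps the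
ball onto itself for small `t`: the extension of `g` by zero has the same Lipschitz constant, so the
contraction principle applies. -/
theorem exists_add_smul_eq_of_lipschitzOnWith [CompleteSpace E] {g : E → E} {L : ℝ≥0}
    (hg : LipschitzOnWith L g (Metric.closedBall 0 1)) (hg0 : ∀ x, ‖x‖ = 1 → g x = 0)
    {t : ℝ} (ht : 0 ≤ t) (htL : t * L < 1) {y : E} (hy : ‖y‖ ≤ 1) :
    ∃ x, ‖x‖ ≤ 1 ∧ x + t • g x = y := by
  classical
  let G : E → E := fun x => if ‖x‖ ≤ 1 then g x else 0
  have aux : ∀ x z : E, ‖x‖ ≤ 1 → 1 < ‖z‖ → ‖g x‖ ≤ L * ‖x - z‖ := by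
    intro x z hx hz
    obtain ⟨w, hw, hw1⟩ : ∃ w ∈ segment ℝ x z, ‖w‖ = 1 :=
      (convex_segment x z).isPreconnected.intermediate_value (left_mem_segment ℝ x z)
        (right_mem_segment ℝ x z) continuous_norm.continuousOn ⟨hx, hz.le⟩
    have h1 := hg.norm_sub_le (x := x) (y := w) (by simpa using hx) (by simp [hw1])
    rw [hg0 w hw1, sub_zero] at h1
    refine h1.trans (mul_le_mul_of_nonneg_left ?_ L.2)
    obtain ⟨p, q, hp, hq, hpq, rfl⟩ := hw
    have : x - (p • x + q • z) = q • (x - z) := by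
      obtain rfl : p = 1 - q := by linarith
      module
    rw [this, norm_smul, Real.norm_of_nonneg hq]
    exact mul_le_of_le_one_left (norm_nonneg _) (by linarith)
  have hG : ∀ x z, ‖G x - G z‖ ≤ L * ‖x - z‖ := by
    intro x z
    by_cases hx : ‖x‖ ≤ 1 <;> by_cases hz : ‖z‖ ≤ 1
    · simpa [G, hx, hz] using hg.norm_sub_le (x := x) (y := z) (by simpa using hx)
        (by simpa using hz)
    · simpa [G, hx, hz] using aux x z hx (not_le.1 hz)
    · simpa [G, hx, hz, norm_sub_rev] using aux z x hz (not_le.1 hx)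
    · simp only [G, hx, hz, if_false, sub_zero, norm_zero]
      positivity
  have hcon : ContractingWith (Real.toNNReal t * L) fun x => y - t • G x := by
    refine ⟨by rw [← NNReal.coe_lt_coe]; simpa [ht] using htL,
      LipschitzWith.of_dist_le_mul fun x z => ?_⟩
    rw [dist_eq_norm, dist_eq_norm]
    have : y - t • G x - (y - t • G z) = t • (G z - G x) := by module
    rw [this, norm_smul, Real.norm_of_nonneg ht, norm_sub_rev]
    calc t * ‖G x - G z‖ ≤ t * (L * ‖x - z‖) := mul_le_mul_of_nonneg_left (hG x z) ht
      _ = _ := by simp [ht, mul_assoc]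
  have hfix : y - t • G (hcon.fixedPoint) = hcon.fixedPoint := hcon.fixedPoint_isFixedPt
  set x := hcon.fixedPoint
  have hx : ‖x‖ ≤ 1 := by
    by_contra h
    rw [show G x = 0 by simp [G, h], smul_zero, sub_zero] at hfix
    exact h (hfix ▸ hy)
  refine ⟨x, hx, ?_⟩
  rw [show G x = g x by simp [G, hx]] at hfix
  exact (sub_eq_iff_eq_add.1 hfix).symm

omit [MeasurableSpace E] [BorelSpace E] in
/-- The image of the derivative is orthogonal to `r x`, because `‖r‖²` is locally constant. -/
theorem det_fderiv_eq_zero_of_norm_eventually_eq_one {r : E → E} {x : E}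
    (hd : DifferentiableAt ℝ r x) (hr1 : ∀ᶠ y in 𝓝 x, ‖r y‖ = 1) : (fderiv ℝ r x).det = 0 := by
  by_contra hne
  have hu : IsUnit (LinearMap.det (fderiv ℝ r x : E →ₗ[ℝ] E)) := isUnit_iff_ne_zero.2 hne
  have hsurj := ((Module.End.isUnit_iff _).1 ((LinearMap.isUnit_iff_isUnit_det _).2 hu)).2
  have hnorm : HasFDerivAt (fun y => ‖r y‖ ^ 2) (2 • (innerSL ℝ (r x)).comp (fderiv ℝ r x)) x :=
    hd.hasFDerivAt.norm_sq
  have hz : HasFDerivAt (fun y => ‖r y‖ ^ 2) (0 : E →L[ℝ] ℝ) x :=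
    (hasFDerivAt_const (1 : ℝ) x).congr_of_eventuallyEq (hr1.mono fun y hy => by simp [hy])
  obtain ⟨v, hv⟩ := hsurj (r x)
  have hv' : fderiv ℝ r x v = r x := hv
  have h := DFunLike.congr_fun (hnorm.unique hz) v
  simp [hv', hr1.self_of_nhds] at h

omit [MeasurableSpace E] [BorelSpace E] in
/-- There is no `C¹` retraction of the closed unit ball onto the unit sphere (Milnor, Rogers). With
`g = r - id`, the map `x ↦ x + t g(x)` is for small `t > 0` a bijection of the ball with positive
Jacobian, so the integral of the Jacobian is the volume of the ball; this persists at `t = 1`, where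
the map is `r` and its Jacobian vanishes. -/
theorem not_exists_contDiff_retraction {r : E → E}
    (hr : ∀ x ∈ Metric.closedBall (0 : E) 1, ContDiffAt ℝ 1 r x)
    (hr1 : ∀ x ∈ Metric.closedBall (0 : E) 1, ∀ᶠ y in 𝓝 x, ‖r y‖ = 1)
    (hr0 : ∀ x, ‖x‖ = 1 → r x = x) : False := by
  borelize E
  set B := Metric.closedBall (0 : E) 1 with hBdef
  have hB : IsCompact B := isCompact_closedBall 0 1
  have hBm : ∀ {x}, x ∈ B ↔ ‖x‖ ≤ 1 := by simp [B]
  have hd : ∀ x ∈ B, DifferentiableAt ℝ r x := fun x hx => (hr x hx).differentiableAt one_ne_zero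
  let A : E → E →L[ℝ] E := fun x => fderiv ℝ r x - 1
  have hAc : ContinuousOn A B := fun x hx =>
    ((((hr x hx).fderiv_right (m := 0) (by norm_num)).continuousAt).sub
      continuousAt_const).continuousWithinAt
  let g : E → E := fun x => r x - x
  have hgd : ∀ x ∈ B, HasFDerivAt g (A x) x := fun x hx =>
    (hd x hx).hasFDerivAt.sub (hasFDerivAt_id x)
  obtain ⟨C, hC⟩ := hB.exists_bound_of_continuousOn hAc
  let L : ℝ≥0 := Real.toNNReal C + 1
  have hAL : ∀ x ∈ B, ‖A x‖ ≤ L := fun x hx =>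
    (hC x hx).trans ((Real.le_coe_toNNReal C).trans (by simp [L]))
  have hL0 : (0 : ℝ) < L := by positivity
  have hgL : LipschitzOnWith L g B :=
    (convex_closedBall 0 1).lipschitzOnWith_of_nnnorm_hasFDerivWithin_le
      (fun x hx => (hgd x hx).hasFDerivWithinAt) fun x hx => hAL x hx
  have hg0 : ∀ x, ‖x‖ = 1 → g x = 0 := fun x hx => by simp [g, hr0 x hx]
  -- near the identity the determinant is positive
  obtain ⟨δ, hδ, hdet⟩ : ∃ δ > 0, ∀ M : E →L[ℝ] E, ‖M‖ < δ → 0 < (1 + M).det := by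
    have h : ∀ᶠ M in 𝓝 (0 : E →L[ℝ] E), 0 < (1 + M).det := by
      have hc : ContinuousAt (fun M : E →L[ℝ] E => (1 + M).det) 0 :=
        (ContinuousLinearMap.continuous_det.comp (continuous_const.add continuous_id)).continuousAt
      refine hc.eventually (lt_mem_nhds ?_)
      simp [ContinuousLinearMap.det]
    obtain ⟨δ, hδ, h⟩ := Metric.eventually_nhds_iff.1 h
    exact ⟨δ, hδ, fun M hM => h (by simpa using hM)⟩
  have hball : ∀ t ∈ Ioo 0 (min (min 1 δ) 1 / L), ∫ x in B, (1 + t • A x).det =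
      (volume B).toReal := by
    intro t ht
    have htm : t * L < min (min 1 δ) 1 := (lt_div_iff₀ hL0).1 ht.2
    have htL : t * L < 1 := htm.trans_le (min_le_right _ _)
    have htδ : t * L < δ := htm.trans_le ((min_le_left _ _).trans (min_le_right _ _))
    have ht1 : t ≤ 1 := by
      have : (1 : ℝ) ≤ L := by simp [L]
      nlinarith [ht.1]
    let φ : E → E := fun x => x + t • g x
    have hφd : ∀ x ∈ B, HasFDerivWithinAt φ (1 + t • A x) B x := fun x hx =>
      ((hasFDerivAt_id x).add ((hgd x hx).const_smul t)).hasFDerivWithinAt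
    have hφi : InjOn φ B := by
      intro x hx y hy hxy
      have h1 : x - y = t • (g y - g x) := by
        have : x + t • g x = y + t • g y := hxy
        rw [smul_sub, sub_eq_sub_iff_add_eq_add, this, add_comm]
      have h2 := hgL.norm_sub_le hy hx
      have h3 : ‖x - y‖ ≤ t * L * ‖x - y‖ := by
        nth_rw 1 [h1]
        rw [norm_smul, Real.norm_of_nonneg ht.1.le, mul_assoc, norm_sub_rev x y]
        exact mul_le_mul_of_nonneg_left h2 ht.1.le
      have h4 : ‖x - y‖ = 0 := by nlinarith [norm_nonneg (x - y)]
      exact sub_eq_zero.1 (norm_eq_zero.1 h4)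
    have hφB : φ '' B = B := by
      refine Subset.antisymm ?_ fun y hy => ?_
      · rintro _ ⟨x, hx, rfl⟩
        have : φ x = (1 - t) • x + t • r x := by simp only [φ, g]; module
        rw [this]
        exact convex_closedBall 0 1 hx (hBm.2 (hr1 x hx).self_of_nhds.le) (by linarith) ht.1.le
          (by ring)
      · obtain ⟨x, hx, hxy⟩ := exists_add_smul_eq_of_lipschitzOnWith hgL hg0 ht.1.le htL (hBm.1 hy)
        exact ⟨x, hBm.2 hx, hxy⟩
    have hcv := lintegral_abs_det_fderiv_eq_addHaar_image volume hB.measurableSet hφd hφi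
    rw [hφB] at hcv
    have hpos : ∀ x ∈ B, 0 < (1 + t • A x).det := fun x hx => hdet _ (by
      rw [norm_smul, Real.norm_of_nonneg ht.1.le]
      exact (mul_le_mul_of_nonneg_left (hAL x hx) ht.1.le).trans_lt htδ)
    rw [← hcv, integral_eq_lintegral_of_nonneg_ae]
    · congr 1
      refine setLIntegral_congr_fun hB.measurableSet fun x hx => ?_
      rw [abs_of_pos (hpos x hx)]
    · filter_upwards [ae_restrict_mem hB.measurableSet] with x hx using (hpos x hx).le
    · exact (ContinuousLinearMap.continuous_det.comp_continuousOn
        (continuousOn_const.add (hAc.const_smul t))).aestronglyMeasurable hB.measurableSet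
  have h1 := integral_det_one_add_eq hB hAc (by positivity) hball
  have h0 : ∫ x in B, (1 + A x).det = 0 := by
    refine setIntegral_eq_zero_of_forall_eq_zero fun x hx => ?_
    rw [show 1 + A x = fderiv ℝ r x by simp [A]]
    exact det_fderiv_eq_zero_of_norm_eventually_eq_one (hd x hx) (hr1 x hx)
  rw [h0] at h1
  have : 0 < (volume B).toReal :=
    ENNReal.toReal_pos (Metric.measure_closedBall_pos volume 0 one_pos).ne' hB.measure_lt_top.ne
  linarith

end Brouwer

/-! ### Brouwer's fixed point theorem -/

section BrouwerFixedPoint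

open scoped RealInnerProductSpace

variable {E : Type*} [NormedAddCommGroup E] [InnerProductSpace ℝ E] [FiniteDimensional ℝ E]

/-- Brouwer's theorem for `C¹` maps. Were there no fixed point, sending `x` to the point where the
ray from `p x` through `x` leaves the ball would be a `C¹` retraction onto the sphere. -/
theorem exists_fixedPoint_of_contDiff {p : E → E} (hp : ContDiff ℝ 1 p)
    (hpB : ∀ x, ‖x‖ ≤ 1 → ‖p x‖ ≤ 1) : ∃ x, ‖x‖ ≤ 1 ∧ p x = x := by
  by_contra! hne
  let u : E → E := fun x => x - p x
  -- `s x` is the larger root of `‖x + s u(x)‖² = 1`, and `D x` is a quarter of the discriminant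
  let D : E → ℝ := fun x => ⟪x, u x⟫ ^ 2 + ‖u x‖ ^ 2 * (1 - ‖x‖ ^ 2)
  let s : E → ℝ := fun x => (-⟪x, u x⟫ + √(D x)) / ‖u x‖ ^ 2
  have hu : ContDiff ℝ 1 u := contDiff_id.sub hp
  have hD : ContDiff ℝ 1 D :=
    ((contDiff_id.inner ℝ hu).pow 2).add
      ((hu.norm_sq ℝ).mul (contDiff_const.sub (contDiff_id.norm_sq ℝ)))
  have hu0 : ∀ x, ‖x‖ ≤ 1 → u x ≠ 0 := fun x hx h => hne x hx (sub_eq_zero.1 h).symm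
  have hinner : ∀ x, ‖x‖ = 1 → 0 < ⟪x, u x⟫ := by
    intro x hx
    have h1 : ⟪x, u x⟫ = 1 - ⟪x, p x⟫ := by
      simp [u, inner_sub_right, hx]
    have h2 : ‖u x‖ ^ 2 = ‖x‖ ^ 2 - 2 * ⟪x, p x⟫ + ‖p x‖ ^ 2 := norm_sub_sq_real x (p x)
    have h3 : 0 < ‖u x‖ ^ 2 := pow_pos (norm_pos_iff.2 (hu0 x hx.le)) 2
    have h4 : ‖p x‖ ^ 2 ≤ 1 := pow_le_one₀ (norm_nonneg _) (hpB x hx.le)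
    rw [hx] at h2
    rw [h1]
    linarith
  have hD0 : ∀ x, ‖x‖ ≤ 1 → 0 < D x := by
    intro x hx
    have h3 : 0 < ‖u x‖ ^ 2 := pow_pos (norm_pos_iff.2 (hu0 x hx)) 2
    rcases hx.lt_or_eq with h | h
    · have : 0 < 1 - ‖x‖ ^ 2 := by nlinarith [norm_nonneg x]
      positivity
    · have := hinner x h
      simp only [D, h]
      positivity
  refine not_exists_contDiff_retraction (r := fun x => x + s x • u x) ?_ ?_ ?_
  · intro x hx
    have hx1 : ‖x‖ ≤ 1 := by simpa using hx
    have hs : ContDiffAt ℝ 1 s x :=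
      ((contDiff_id.inner ℝ hu).neg.contDiffAt.add
        (hD.contDiffAt.sqrt (hD0 x hx1).ne')).div (hu.norm_sq ℝ).contDiffAt
        (pow_ne_zero 2 (norm_ne_zero_iff.2 (hu0 x hx1)))
    exact contDiffAt_id.add (hs.smul hu.contDiffAt)
  · intro x hx
    have hx1 : ‖x‖ ≤ 1 := by simpa using hx
    filter_upwards [hu.continuous.continuousAt.eventually_ne (hu0 x hx1),
      hD.continuous.continuousAt.eventually (lt_mem_nhds (hD0 x hx1))] with y hy hDy
    have hn : ‖u y‖ ^ 2 ≠ 0 := pow_ne_zero 2 (norm_ne_zero_iff.2 hy)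
    have hsq : √(D y) ^ 2 = D y := Real.sq_sqrt hDy.le
    have h1 : ‖y + s y • u y‖ ^ 2 = ‖y‖ ^ 2 + 2 * (s y * ⟪y, u y⟫) + s y ^ 2 * ‖u y‖ ^ 2 := by
      rw [norm_add_sq_real, inner_smul_right, norm_smul, mul_pow, Real.norm_eq_abs, sq_abs]
    have h2 : s y * ‖u y‖ ^ 2 = -⟪y, u y⟫ + √(D y) := div_mul_cancel₀ _ hn
    have h3 : ‖y + s y • u y‖ ^ 2 = 1 := by
      rw [h1]
      refine mul_left_cancel₀ hn ?_
      have hDd : D y = ⟪y, u y⟫ ^ 2 + ‖u y‖ ^ 2 * (1 - ‖y‖ ^ 2) := rfl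
      linear_combination (2 * ⟪y, u y⟫ + s y * ‖u y‖ ^ 2 - ⟪y, u y⟫ + √(D y)) * h2 + hsq + hDd
    exact (pow_eq_one_iff_of_nonneg (norm_nonneg _) two_ne_zero).1 h3
  · intro x hx
    have h : s x = 0 := by
      simp [s, D, hx, Real.sqrt_sq (hinner x hx).le]
    simp [h]

/-- Brouwer's theorem for a continuous map of the whole space into the closed unit ball, obtained
from the `C¹` case by smooth approximation, rescaled so as to preserve the ball. -/
theorem exists_fixedPoint_of_continuous {F : E → E} (hF : Continuous F) (hF1 : ∀ x, ‖F x‖ ≤ 1) :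
    ∃ x, F x = x := by
  have hB : IsCompact (Metric.closedBall (0 : E) 1) := isCompact_closedBall 0 1
  obtain ⟨x, hx, hmin⟩ := hB.exists_isMinOn ⟨0, by simp⟩
    (hF.sub continuous_id).norm.continuousOn
  refine ⟨x, ?_⟩
  by_contra hne
  set m := ‖F x - x‖ with hm
  have hm0 : 0 < m := norm_pos_iff.2 (sub_ne_zero.2 hne)
  set η := m / 4 with hη
  have hη0 : 0 < η := by positivity
  obtain ⟨G, hG, hGF, -⟩ := hF.exists_contDiff_approx 1 (ε := fun _ => η) continuous_const
    fun _ => hη0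
  have hGn : ∀ y, ‖G y‖ ≤ 1 + η := fun y => by
    have h1 := hGF y
    rw [dist_eq_norm] at h1
    calc ‖G y‖ = ‖F y + (G y - F y)‖ := by congr 1; abel
      _ ≤ ‖F y‖ + ‖G y - F y‖ := norm_add_le _ _
      _ ≤ 1 + η := add_le_add (hF1 y) h1.le
  obtain ⟨y, hy, hfix⟩ := exists_fixedPoint_of_contDiff (p := fun y => (1 + η)⁻¹ • G y)
    (contDiff_const.smul hG) (fun y _ => by
      rw [norm_smul, norm_inv, Real.norm_of_nonneg (by positivity), inv_mul_le_iff₀ (by positivity)]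
      simpa using hGn y)
  have h1 : G y = y + η • y := by
    have : G y = (1 + η) • y := by
      rw [← hfix, smul_inv_smul₀ (by positivity), hfix]
    rw [this, add_smul, one_smul]
  have h2 : m ≤ ‖F y - y‖ := hmin (by simpa using hy)
  have h3 : ‖F y - y‖ ≤ η + η := by
    have h4 := hGF y
    rw [dist_comm, dist_eq_norm] at h4
    calc ‖F y - y‖ = ‖(F y - G y) + η • y‖ := by rw [h1]; congr 1; abel
      _ ≤ ‖F y - G y‖ + ‖η • y‖ := norm_add_le _ _
      _ ≤ η + η := by
        refine add_le_add h4.le ?_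
        rw [norm_smul, Real.norm_of_nonneg hη0.le]
        exact mul_le_of_le_one_right hη0.le hy
  linarith

end BrouwerFixedPoint

/-! ### Brouwer's theorem on the standard simplex -/

section Simplex

variable {ι : Type*} [Fintype ι] [Nonempty ι]

/-- A continuous retraction of `ℝ^ι` onto the standard simplex. The positive part of `x` is topped
up uniformly to total mass at least `1`, then divided by its total mass. -/
noncomputable def simplexRetraction (x : ι → ℝ) (i : ι) : ℝ :=
  (max (x i) 0 + max (1 - ∑ j, max (x j) 0) 0 / Fintype.card ι) / max (∑ j, max (x j) 0) 1

omit [Nonempty ι] in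
theorem continuous_simplexRetraction : Continuous (simplexRetraction (ι := ι)) := by
  refine continuous_pi fun i => Continuous.div (by fun_prop) (by fun_prop) fun x => ?_
  exact (zero_lt_one.trans_le (le_max_right _ _)).ne'

theorem simplexRetraction_mem (x : ι → ℝ) : simplexRetraction x ∈ stdSimplex ℝ ι := by
  have h1 : 0 < max (∑ j, max (x j) 0) 1 := zero_lt_one.trans_le (le_max_right _ _)
  refine ⟨fun i => div_nonneg (by positivity) h1.le, ?_⟩
  simp only [simplexRetraction]
  rw [← Finset.sum_div, Finset.sum_add_distrib, div_eq_one_iff_eq h1.ne', Finset.sum_const,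
    Finset.card_univ, nsmul_eq_mul, mul_div_cancel₀ _ (by simp)]
  rcases le_total (∑ j, max (x j) 0) 1 with h | h
  · rw [max_eq_left (by linarith), max_eq_right h]; ring
  · rw [max_eq_right (by linarith), max_eq_left h]; ring

omit [Nonempty ι] in
theorem simplexRetraction_of_mem {x : ι → ℝ} (hx : x ∈ stdSimplex ℝ ι) :
    simplexRetraction x = x := by
  have h : ∀ i, max (x i) 0 = x i := fun i => max_eq_left (hx.1 i)
  ext i
  simp [simplexRetraction, h, hx.2]

theorem exists_fixedPoint_stdSimplex {f : (ι → ℝ) → ι → ℝ}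
    (hf : ContinuousOn f (stdSimplex ℝ ι)) (hfm : MapsTo f (stdSimplex ℝ ι) (stdSimplex ℝ ι)) :
    ∃ x ∈ stdSimplex ℝ ι, f x = x := by
  let F : EuclideanSpace ℝ ι → EuclideanSpace ℝ ι := fun y =>
    WithLp.toLp 2 (f (simplexRetraction y.ofLp))
  have hF : Continuous F :=
    (PiLp.continuous_toLp 2 _).comp (hf.comp_continuous
      (continuous_simplexRetraction.comp (PiLp.continuous_ofLp 2 _))
      fun y => simplexRetraction_mem _)
  obtain ⟨y, hy⟩ := exists_fixedPoint_of_continuous hF fun y => by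
    have hm := hfm (simplexRetraction_mem y.ofLp)
    rw [EuclideanSpace.norm_eq, ← Real.sqrt_one]
    refine Real.sqrt_le_sqrt ?_
    rw [← hm.2]
    refine Finset.sum_le_sum fun i _ => ?_
    have h1 : f (simplexRetraction y.ofLp) i ≤ 1 := by
      rw [← hm.2]
      exact Finset.single_le_sum (fun j _ => hm.1 j) (Finset.mem_univ i)
    rw [Real.norm_eq_abs, sq_abs]
    simp only [F]
    nlinarith [hm.1 i]
  have hy' : f (simplexRetraction y.ofLp) = y.ofLp := congrArg WithLp.ofLp hy
  have hmem : y.ofLp ∈ stdSimplex ℝ ι := hy' ▸ hfm (simplexRetraction_mem _)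
  exact ⟨y.ofLp, hmem, by rwa [simplexRetraction_of_mem hmem] at hy'⟩

end Simplex

/-! ### Schauder's theorem and fixed points in conical shells -/

section Schauder

variable {X : Type*} [NormedAddCommGroup X] [NormedSpace ℝ X]

/-- Approximate fixed points, by the Schauder projection: a finite `ε`-net `t` of `K` and
a partition of unity turn `f` into a self-map of the simplex over `t`. -/
theorem exists_norm_sub_le_of_mapsTo_compact {C K : Set X} (hC : Convex ℝ C) (hCn : C.Nonempty)
    (hK : IsCompact K) (hKC : K ⊆ C) {f : X → X} (hf : ContinuousOn f C) (hfK : MapsTo f C K)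
    {ε : ℝ} (hε : 0 < ε) : ∃ x ∈ C, ‖x - f x‖ ≤ ε := by
  obtain ⟨t, htK, hcov⟩ := hK.elim_nhds_subcover (fun y => Metric.ball y ε)
    fun y _ => Metric.ball_mem_nhds y hε
  let w : t → X → ℝ := fun j z => max (ε - ‖z - j‖) 0
  let S : X → ℝ := fun z => ∑ j, w j z
  have hw0 : ∀ j z, 0 ≤ w j z := fun j z => le_max_right _ _
  have hwc : ∀ j, Continuous (w j) := fun j => by fun_prop
  have hS : ∀ z ∈ K, 0 < S z := by
    intro z hz
    obtain ⟨y, hy, hzy⟩ := mem_iUnion₂.1 (hcov hz)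
    refine Finset.sum_pos' (fun j _ => hw0 j z) ⟨⟨y, hy⟩, Finset.mem_univ _, ?_⟩
    rw [Metric.mem_ball, dist_eq_norm] at hzy
    exact lt_max_of_lt_left (sub_pos.2 hzy)
  obtain ⟨x₀, hx₀⟩ := hCn
  have : Nonempty t := by
    obtain ⟨y, hy, -⟩ := mem_iUnion₂.1 (hcov (hfK hx₀))
    exact ⟨⟨y, hy⟩⟩
  let v : (t → ℝ) → X := fun p => ∑ j, p j • (j : X)
  have hvc : Continuous v := by fun_prop
  have hvC : MapsTo v (stdSimplex ℝ t) C := fun p hp =>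
    hC.sum_mem (fun j _ => hp.1 j) hp.2 fun j _ => hKC (htK j j.2)
  obtain ⟨p, hp, hfix⟩ := exists_fixedPoint_stdSimplex
    (f := fun p j => w j (f (v p)) / S (f (v p)))
    (continuousOn_pi.2 fun j => by
      have hfv := hf.comp hvc.continuousOn hvC
      refine ((hwc j).comp_continuousOn hfv).div
        ((continuous_finsetSum _ fun j _ => hwc j).comp_continuousOn hfv) fun p hp => ?_
      exact (hS _ (hfK (hvC hp))).ne')
    (fun p hp => ⟨fun j => div_nonneg (hw0 _ _) (hS _ (hfK (hvC hp))).le, by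
      rw [← Finset.sum_div]
      exact div_self (hS _ (hfK (hvC hp))).ne'⟩)
  refine ⟨v p, hvC hp, ?_⟩
  have h1 : v p - f (v p) = ∑ j, p j • ((j : X) - f (v p)) := by
    simp_rw [smul_sub, Finset.sum_sub_distrib, ← Finset.sum_smul, hp.2, one_smul]
    rfl
  have h2 : ∀ j, p j * ‖(j : X) - f (v p)‖ ≤ p j * ε := by
    intro j
    rcases le_total ‖(j : X) - f (v p)‖ ε with h | h
    · exact mul_le_mul_of_nonneg_left h (hp.1 j)
    · have : p j = 0 := by
        rw [← hfix]
        have : w j (f (v p)) = 0 := max_eq_right (by rw [norm_sub_rev]; linarith)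
        simp [this]
      simp [this]
  rw [h1]
  calc ‖∑ j, p j • ((j : X) - f (v p))‖ ≤ ∑ j, ‖p j • ((j : X) - f (v p))‖ := norm_sum_le _ _
    _ = ∑ j, p j * ‖(j : X) - f (v p)‖ := by
      simp_rw [norm_smul, Real.norm_eq_abs, abs_of_nonneg (hp.1 _)]
    _ ≤ ∑ j, p j * ε := Finset.sum_le_sum fun j _ => h2 j
    _ = ε := by rw [← Finset.sum_mul, hp.2, one_mul]

/-- Schauder's fixed point theorem, for a map of a convex set into a compact subset of it. -/
theorem exists_fixedPoint_of_mapsTo_compact {C K : Set X} (hC : Convex ℝ C) (hCn : C.Nonempty)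
    (hK : IsCompact K) (hKC : K ⊆ C) {f : X → X} (hf : ContinuousOn f C) (hfK : MapsTo f C K) :
    ∃ x ∈ C, f x = x := by
  choose x hxC hx using fun k : ℕ => exists_norm_sub_le_of_mapsTo_compact hC hCn hK hKC hf hfK
    (Nat.one_div_pos_of_nat (α := ℝ) (n := k))
  obtain ⟨z, hz, φ, hφ, hlim⟩ := hK.tendsto_subseq fun k => hfK (hxC k)
  have h0 : Tendsto (fun k => x (φ k) - f (x (φ k))) atTop (𝓝 0) :=
    squeeze_zero_norm (fun k => hx (φ k))
      ((tendsto_one_div_add_atTop_nhds_zero_nat (𝕜 := ℝ)).comp hφ.tendsto_atTop)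
  have hxz : Tendsto (fun k => x (φ k)) atTop (𝓝 z) := by
    simpa using h0.add hlim
  have hfz := (hf z (hKC hz)).tendsto.comp
    (tendsto_nhdsWithin_iff.2 ⟨hxz, Eventually.of_forall fun k => hxC (φ k)⟩)
  exact ⟨z, hKC hz, tendsto_nhds_unique hfz hlim⟩

/-- A form of Krasnoselskii's theorem in which a linear functional `α` takes the role of the norm.
The sign of `κ` separates compression (`κ > 0`) from expansion (`κ < 0`). Since the shell
`{x ∈ C | r ≤ α x ≤ R}` is convex, Schauder's theorem applies to `x ↦ (β x / α (f x)) • f x`, where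
`β x` is `α x + κ (α (f x) - α x)` clamped to `[r, R]`; the boundary conditions force
`α (f x) = α x` at a fixed point of that map. -/
theorem exists_fixedPoint_of_cone {C K : Set X} (hC : Convex ℝ C) (hCcl : IsClosed C)
    (hCsmul : ∀ c : ℝ, 0 < c → ∀ x ∈ C, c • x ∈ C) (α : X →L[ℝ] ℝ) {r R : ℝ} (hr : 0 < r)
    (hrR : r ≤ R) (hne : ∃ x ∈ C, 0 < α x) (hK : IsCompact K) {f : X → X}
    (hf : ContinuousOn f {x ∈ C | α x ∈ Icc r R})
    (hfC : MapsTo f {x ∈ C | α x ∈ Icc r R} C) (hfK : MapsTo f {x ∈ C | α x ∈ Icc r R} K)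
    {δ : ℝ} (hδ : 0 < δ) (hfδ : ∀ x ∈ C, α x ∈ Icc r R → δ ≤ α (f x)) (κ : ℝ) (hκ : κ ≠ 0)
    (hfr : ∀ x ∈ C, α x = r → 0 ≤ κ * (α (f x) - r))
    (hfR : ∀ x ∈ C, α x = R → κ * (α (f x) - R) ≤ 0) :
    ∃ x ∈ C, α x ∈ Icc r R ∧ f x = x := by
  set A : Set X := {x ∈ C | α x ∈ Icc r R} with hA
  -- the level to which the image of `x` is rescaled
  let β : X → ℝ := fun x => max r (min R (α x + κ * (α (f x) - α x)))
  have hβ : ∀ x, β x ∈ Icc r R := fun x => ⟨le_max_left _ _, max_le hrR (min_le_left _ _)⟩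
  have hαf : ContinuousOn (fun x => α (f x)) A := α.continuous.comp_continuousOn hf
  have hβc : ContinuousOn β A :=
    continuousOn_const.sup (continuousOn_const.inf
      (α.continuous.continuousOn.add (continuousOn_const.mul
        (hαf.sub α.continuous.continuousOn))))
  let K' : Set X := K ∩ (C ∩ {x | δ ≤ α x})
  have hK' : IsCompact K' := hK.inter_right
    (hCcl.inter (isClosed_le continuous_const α.continuous))
  let q : ℝ × X → X := fun z => (z.1 / α z.2) • z.2
  have hq : ContinuousOn q (Icc r R ×ˢ K') :=
    (continuousOn_fst.div (α.continuous.comp_continuousOn continuousOn_snd)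
      fun z hz => (hδ.trans_le hz.2.2.2).ne').smul continuousOn_snd
  have hfK' : ∀ x ∈ A, f x ∈ K' := fun x hx => ⟨hfK hx, hfC hx, hfδ x hx.1 hx.2⟩
  have hqA : q '' (Icc r R ×ˢ K') ⊆ A := by
    rintro _ ⟨⟨b, y⟩, ⟨hb, hy⟩, rfl⟩
    have hy0 : 0 < α y := hδ.trans_le hy.2.2
    refine ⟨hCsmul _ (div_pos (hr.trans_le hb.1) hy0) _ hy.2.1, ?_⟩
    simpa [q, div_mul_cancel₀ _ hy0.ne'] using hb
  have hAconv : Convex ℝ A :=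
    hC.inter ((convex_Icc r R).is_linear_preimage α.toLinearMap.isLinear)
  have hAne : A.Nonempty := by
    obtain ⟨x, hx, hx0⟩ := hne
    refine ⟨(r / α x) • x, hCsmul _ (div_pos hr hx0) _ hx, ?_⟩
    simp [div_mul_cancel₀ _ hx0.ne', hrR]
  obtain ⟨x, hx, hfix⟩ := exists_fixedPoint_of_mapsTo_compact hAconv hAne
    ((isCompact_Icc.prod hK').image_of_continuousOn hq) hqA (f := fun x => q (β x, f x))
    (hq.comp (hβc.prodMk hf) fun x hx => ⟨hβ x, hfK' x hx⟩)
    (fun x hx => mem_image_of_mem q ⟨hβ x, hfK' x hx⟩)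
  have hfx0 : 0 < α (f x) := hδ.trans_le (hfδ x hx.1 hx.2)
  have hαx : α x = β x := by
    have := congrArg α hfix
    simpa [q, div_mul_cancel₀ _ hfx0.ne'] using this.symm
  -- the clamp in `β` is not active at the fixed point
  have heq : κ * (α (f x) - α x) = 0 := by
    have hβx : β x = max r (min R (α x + κ * (α (f x) - α x))) := rfl
    have hr' := hfr x hx.1
    have hR' := hfR x hx.1
    have hx1 := hx.2.1
    have hx2 := hx.2.2
    rw [← hαx] at hβx
    set k := κ * (α (f x) - α x) with hk
    rcases lt_trichotomy k 0 with h | h | h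
    · have : min R (α x + k) = α x + k := min_eq_right (by linarith)
      rw [this] at hβx
      have h3 : α x = r := by
        rcases le_total r (α x + k) with h4 | h4
        · rw [max_eq_right h4] at hβx; linarith
        · rw [max_eq_left h4] at hβx; exact hβx
      have := hr' h3
      rw [← h3, ← hk] at this
      linarith
    · exact h
    · have h3 : α x = R := by
        rcases le_total R (α x + k) with h4 | h4
        · rw [min_eq_left h4, max_eq_right hrR] at hβx; exact hβx
        · rw [min_eq_right h4, max_eq_right (by linarith)] at hβx; linarith
      have := hR' h3
      rw [← h3, ← hk] at this
      linarith
  have hαeq : α (f x) = α x := by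
    have := (mul_eq_zero.1 heq).resolve_left hκ
    linarith
  refine ⟨x, hx.1, hx.2, ?_⟩
  have h : (β x / α (f x)) • f x = x := hfix
  rwa [← hαx, hαeq, div_self (hαeq ▸ hfx0).ne', one_smul] at h

end Schauder

/-! ### Periodic extension and periodic solutions -/

section Periodic

theorem exists_periodic_eqOn {Y : Type*} {T : ℝ} (hT : 0 < T) (u : ℝ → Y) (hu : u 0 = u T) :
    ∃ v : ℝ → Y, Function.Periodic v T ∧ ∀ t ∈ Icc 0 T, v t = u t := by
  refine ⟨fun t => u (toIcoMod hT 0 t), fun t => by simp, fun t ht => ?_⟩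
  rcases ht.2.lt_or_eq with h | rfl
  · show u _ = u t
    rw [(toIcoMod_eq_self hT).2 ⟨ht.1, by simpa using h⟩]
  · have : toIcoMod hT 0 t = 0 := by simpa using toIcoMod_add_right hT 0 0
    simp only [this, hu]

theorem continuous_of_periodic_of_continuousOn {Y : Type*} [TopologicalSpace Y] {T : ℝ}
    (hT : 0 < T) {v : ℝ → Y} (hv : Function.Periodic v T) (hc : ContinuousOn v (Icc 0 T)) :
    Continuous v := by
  have : Fact (0 < T) := ⟨hT⟩
  have h : v = AddCircle.liftIco T 0 v ∘ ((↑) : ℝ → AddCircle T) := by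
    ext t
    have h1 : v (toIcoMod hT 0 t) = v t := hv.sub_zsmul_eq _
    have h2 : ((toIcoMod hT 0 t : ℝ) : AddCircle T) = t := by
      rw [toIcoMod, AddCircle.coe_sub, AddCircle.coe_zsmul, AddCircle.coe_period, smul_zero,
        sub_zero]
    rw [Function.comp_apply, ← h1, ← h2, AddCircle.liftIco_coe_apply (toIcoMod_mem_Ico hT 0 t)]
  rw [h]
  refine (AddCircle.liftIco_continuous ?_ ?_).comp (AddCircle.continuous_mk' T)
  · exact (hv 0).symm
  · simpa using hc

theorem hasDerivAt_of_periodic {T : ℝ} (hT : 0 < T) {u v : ℝ → ℝ} (hu : Function.Periodic u T)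
    (hv : Function.Periodic v T)
    (h : ∀ t ∈ Icc 0 T, HasDerivWithinAt u (v t) (Icc 0 T) t) (t : ℝ) :
    HasDerivAt u (v t) t := by
  have key : ∀ t ∈ Ico 0 T, HasDerivAt u (v t) t := by
    intro t ht
    rcases ht.1.eq_or_lt with rfl | h0
    · have hr : HasDerivWithinAt u (v 0) (Ici 0) 0 :=
        (h 0 ⟨le_rfl, hT.le⟩).mono_of_mem_nhdsWithin (Icc_mem_nhdsGE hT)
      have hl : HasDerivWithinAt u (v 0) (Iic 0) 0 := by
        have h1 : HasDerivWithinAt u (v T) (Iic T) T :=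
          (h T ⟨hT.le, le_rfl⟩).mono_of_mem_nhdsWithin (Icc_mem_nhdsLE hT)
        have h2 : HasDerivWithinAt (fun s => s + T) 1 (Iic 0) (0 : ℝ) :=
          ((hasDerivAt_id (0 : ℝ)).add_const T).hasDerivWithinAt
        have h3 := HasDerivWithinAt.comp (h₂ := u) (s' := Iic T) (0 : ℝ)
          (by simpa using h1) h2 fun s hs => by simpa using hs
        rw [mul_one, hv.eq] at h3
        exact h3.congr (fun s _ => (hu s).symm) (hu 0).symm
      have := hr.union hl
      rwa [Ici_union_Iic, hasDerivWithinAt_univ] at this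
    · exact (h t ⟨h0.le, ht.2.le⟩).hasDerivAt (Icc_mem_nhds h0 ht.2)
  have h1 := key (toIcoMod hT 0 t) (by simpa using toIcoMod_mem_Ico hT 0 t)
  have h2 : v (toIcoMod hT 0 t) = v t := hv.sub_zsmul_eq _
  rw [h2] at h1
  have h3 : toIcoMod hT 0 t = t - toIcoDiv hT 0 t • T := rfl
  rw [h3] at h1
  have h4 := h1.comp_sub_const t (toIcoDiv hT 0 t • T)
  refine h4.congr_of_eventuallyEq (Eventually.of_forall fun s => ?_)
  exact (hu.sub_zsmul_eq _).symm

theorem iteratedDeriv_two_eq_of_hasDerivAt {u v w : ℝ → ℝ} (hu : ∀ t, HasDerivAt u (v t) t)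
    (hv : ∀ t, HasDerivAt v (w t) t) : iteratedDeriv 2 u = w := by
  rw [iteratedDeriv_succ, iteratedDeriv_one, funext fun t => (hu t).deriv]
  exact funext fun t => (hv t).deriv

theorem contDiff_two_of_hasDerivAt {u v w : ℝ → ℝ} (hu : ∀ t, HasDerivAt u (v t) t)
    (hv : ∀ t, HasDerivAt v (w t) t) (hw : Continuous w) : ContDiff ℝ 2 u := by
  have h1 : ContDiff ℝ 1 v := by
    rw [contDiff_one_iff_deriv, funext fun t => (hv t).deriv]
    exact ⟨fun t => (hv t).differentiableAt, hw⟩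
  rw [show (2 : WithTop ℕ∞) = 1 + 1 by norm_num, contDiff_succ_iff_deriv,
    funext fun t => (hu t).deriv]
  exact ⟨fun t => (hu t).differentiableAt, by simp, h1⟩

/-- A positive periodic solution of the system of integral equations with the Green functions as
kernels solves the differential system. -/
theorem isPositivePeriodicSolution_of_integral_eq {n : ℕ} (hn : 1 ≤ n) {T : ℝ} (hT : 0 < T)
    {a g e : Fin n → ℝ → ℝ} {f : Fin n → (Fin n → ℝ) → ℝ} {G : Fin n → ℝ → ℝ → ℝ}
    (hG : ∀ i, IsGreenFunction T (a i) (G i))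
    (hfcont : ∀ i, ContinuousOn (f i) (puncturedOrthant n))
    (ha : ∀ i, Continuous (a i)) (haT : ∀ i, Function.Periodic (a i) T)
    (hg : ∀ i, Continuous (g i)) (hgT : ∀ i, Function.Periodic (g i) T)
    (he : ∀ i, Continuous (e i)) (heT : ∀ i, Function.Periodic (e i) T)
    {lam : ℝ} {x : ℝ → Fin n → ℝ} (hx : Continuous x) (hxT : Function.Periodic x T)
    (hxpos : ∀ t i, 0 < x t i)
    (hint : ∀ i, ∀ t ∈ Icc 0 T,
      x t i = ∫ s in (0 : ℝ)..T, G i t s * (lam * g i s * f i (x s) + lam * e i s)) :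
    IsPositivePeriodicSolution T a g e f lam x := by
  have hxm : ∀ t, x t ∈ puncturedOrthant n := fun t =>
    ⟨fun i => (hxpos t i).le, Finset.sum_pos (fun i _ => abs_pos.2 (hxpos t i).ne')
      ⟨⟨0, hn⟩, Finset.mem_univ _⟩⟩
  have main : ∀ i, ∃ v : ℝ → ℝ, (∀ t, HasDerivAt (fun s => x s i) (v t) t) ∧
      ∀ t, HasDerivAt v (lam * g i t * f i (x t) + lam * e i t - a i t * x t i) t := by
    intro i
    let h : ℝ → ℝ := fun s => lam * g i s * f i (x s) + lam * e i s
    have hc : Continuous h :=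
      ((continuous_const.mul (hg i)).mul ((hfcont i).comp_continuous hx hxm)).add
        (continuous_const.mul (he i))
    have hp : Function.Periodic h T := fun s => by simp only [h, hxT s, hgT i s, heT i s]
    obtain ⟨y, hy1, hy2, -, hy0⟩ := (hG i).solves h hc hp
    obtain ⟨v, hvT, hvy⟩ := exists_periodic_eqOn hT y hy0
    have hxi : Function.Periodic (fun s => x s i) T := fun s => by simp only [hxT s]
    refine ⟨v, hasDerivAt_of_periodic hT hxi hvT fun t ht => ?_,
      hasDerivAt_of_periodic hT hvT (fun s => ?_) fun t ht => ?_⟩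
    · rw [hvy t ht]
      exact (hy1 t ht).congr (fun s hs => hint i s hs) (hint i t ht)
    · simp only [hxT s, hgT i s, heT i s, haT i s]
    · have := (hy2 t ht).congr (fun s hs => hvy s hs) (hvy t ht)
      simpa only [h, ← hint i t ht] using this
  choose v hv1 hv2 using main
  have hcont : ∀ i, Continuous fun t => lam * g i t * f i (x t) + lam * e i t - a i t * x t i :=
    fun i => (((continuous_const.mul (hg i)).mul ((hfcont i).comp_continuous hx hxm)).add
      (continuous_const.mul (he i))).sub ((ha i).mul ((continuous_apply i).comp hx))
  refine ⟨contDiff_pi.2 fun i => contDiff_two_of_hasDerivAt (hv1 i) (hv2 i) (hcont i), hxT, hxpos,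
    fun t i => ?_⟩
  rw [iteratedDeriv_two_eq_of_hasDerivAt (hv1 i) (hv2 i)]
  ring

end Periodic

/-! ### Hammerstein integral operators -/

section Hammerstein

variable {n : ℕ} {T : ℝ}

/-- The Hammerstein operator `(x t)_i ↦ ∫₀ᵀ k_i(t, s) N_i(s, x(s)) ds` on continuous functions on
`[0, T]`. The variable `s` is projected to `[0, T]`, which has no effect on the range of
integration, so that the integrand is defined on `ℝ`. -/
noncomputable def hammerstein (hT : 0 ≤ T) (k : Fin n → ℝ → ℝ → ℝ)
    (hk : ∀ i, Continuous (Function.uncurry (k i))) (N : Fin n → ℝ → (Fin n → ℝ) → ℝ)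
    (hN : ∀ i, Continuous (Function.uncurry (N i))) (x : C(Icc (0 : ℝ) T, Fin n → ℝ)) :
    C(Icc (0 : ℝ) T, Fin n → ℝ) where
  toFun t i := ∫ s in (0 : ℝ)..T, k i t s * N i s (x (projIcc 0 T hT s))
  continuous_toFun := continuous_pi fun i =>
    intervalIntegral.continuous_parametric_intervalIntegral_of_continuous'
      (((hk i).comp ((continuous_subtype_val.comp continuous_fst).prodMk continuous_snd)).mul
        ((hN i).comp (continuous_snd.prodMk
          (x.continuous.comp (continuous_projIcc.comp continuous_snd))))) 0 T

variable (hT : 0 ≤ T) {k : Fin n → ℝ → ℝ → ℝ} (hk : ∀ i, Continuous (Function.uncurry (k i)))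
  {N : Fin n → ℝ → (Fin n → ℝ) → ℝ} (hN : ∀ i, Continuous (Function.uncurry (N i)))

theorem continuous_hammerstein : Continuous (hammerstein hT k hk N hN) := by
  refine ContinuousMap.continuous_of_continuous_uncurry _ (continuous_pi fun i => ?_)
  refine intervalIntegral.continuous_parametric_intervalIntegral_of_continuous'
    (μ := MeasureTheory.volume)
    (f := fun (z : C(Icc (0 : ℝ) T, Fin n → ℝ) × Icc (0 : ℝ) T) s =>
      k i z.2 s * N i s (z.1 (projIcc 0 T hT s))) ?_ 0 T
  refine ((hk i).comp ((continuous_subtype_val.comp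
    (continuous_snd.comp continuous_fst)).prodMk continuous_snd)).mul
    ((hN i).comp (continuous_snd.prodMk ?_))
  exact (continuous_fst.comp continuous_fst).eval (continuous_projIcc.comp continuous_snd)

/-- By Arzelà–Ascoli: the modulus of continuity of `t ↦ k_i(t, ·)` in `L¹` controls the whole
image. -/
theorem isCompact_closure_image_hammerstein {A : Set C(Icc (0 : ℝ) T, Fin n → ℝ)} {B : ℝ}
    (hB : ∀ x ∈ A, ∀ i, ∀ s ∈ Icc 0 T, |N i s (x (projIcc 0 T hT s))| ≤ B) :
    IsCompact (closure (hammerstein hT k hk N hN '' A)) := by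
  let Φ := hammerstein hT k hk N hN
  let ι := ContinuousMap.isometryEquivBoundedOfCompact (Icc (0 : ℝ) T) (Fin n → ℝ)
  obtain ⟨M, hM⟩ : ∃ M, ∀ i, ∀ z ∈ Icc 0 T ×ˢ Icc 0 T, ‖Function.uncurry (k i) z‖ ≤ M := by
    choose M hM using fun i => (isCompact_Icc.prod isCompact_Icc).exists_bound_of_continuousOn
      (s := Icc (0 : ℝ) T ×ˢ Icc (0 : ℝ) T) (hk i).continuousOn
    exact ⟨∑ i, |M i|, fun i z hz => (hM i z hz).trans ((le_abs_self _).trans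
      (Finset.single_le_sum (f := fun i => |M i|) (fun j _ => abs_nonneg _)
        (Finset.mem_univ i)))⟩
  have hNx : ∀ (x : C(Icc (0 : ℝ) T, Fin n → ℝ)) i,
      Continuous fun s => N i s (x (projIcc 0 T hT s)) := fun x i =>
    (hN i).comp (continuous_id.prodMk (x.continuous.comp continuous_projIcc))
  have hkt : ∀ i t, Continuous (k i t) := fun i t =>
    (hk i).comp (continuous_const.prodMk continuous_id)
  have hB' : ∀ x ∈ A, ∀ i, ∀ s ∈ Icc 0 T, |N i s (x (projIcc 0 T hT s))| ≤ |B| :=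
    fun x hx i s hs => (hB x hx i s hs).trans (le_abs_self B)
  have hbound : ∀ x ∈ A, ∀ t, ‖Φ x t‖ ≤ |M| * |B| * |T - 0| := by
    intro x hx t
    refine (pi_norm_le_iff_of_nonneg (by positivity)).2 fun i => ?_
    refine intervalIntegral.norm_integral_le_of_norm_le_const fun s hs => ?_
    rw [uIoc_of_le hT] at hs
    rw [norm_mul]
    exact mul_le_mul ((hM i (t, s) ⟨t.2, Ioc_subset_Icc_self hs⟩).trans (le_abs_self M))
      (hB' x hx i s (Ioc_subset_Icc_self hs)) (norm_nonneg _) (abs_nonneg _)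
  have hequi : Equicontinuous ((↑) : (ι '' (Φ '' A)) → Icc (0 : ℝ) T → Fin n → ℝ) := by
    intro t₀
    let b : Icc (0 : ℝ) T → ℝ := fun t =>
      ∑ i, ∫ s in (0 : ℝ)..T, |k i t₀ s - k i t s| * |B|
    have hbi : ∀ i, Continuous fun t : Icc (0 : ℝ) T =>
        ∫ s in (0 : ℝ)..T, |k i t₀ s - k i t s| * |B| := fun i =>
      intervalIntegral.continuous_parametric_intervalIntegral_of_continuous'
        ((((hkt i t₀).comp continuous_snd).sub
          ((hk i).comp ((continuous_subtype_val.comp continuous_fst).prodMk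
            continuous_snd))).abs.mul continuous_const) 0 T
    have hb : Tendsto b (𝓝 t₀) (𝓝 0) := by
      have h := (continuous_finsetSum Finset.univ fun i _ => hbi i).tendsto t₀
      simpa [b] using h
    refine Metric.equicontinuousAt_of_continuity_modulus b hb _
      (Eventually.of_forall fun t => ?_)
    rintro ⟨_, _, ⟨x, hx, rfl⟩, rfl⟩
    change dist (Φ x t₀) (Φ x t) ≤ b t
    have hterm : ∀ i, 0 ≤ ∫ s in (0 : ℝ)..T, |k i t₀ s - k i t s| * |B| := fun i =>
      intervalIntegral.integral_nonneg hT fun s _ => by positivity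
    refine (dist_pi_le_iff (Finset.sum_nonneg fun i _ => hterm i)).2 fun i => ?_
    refine le_trans ?_ (Finset.single_le_sum (fun j _ => hterm j) (Finset.mem_univ i))
    have hint : ∀ t : ℝ, IntervalIntegrable
        (fun s => k i t s * N i s (x (projIcc 0 T hT s))) MeasureTheory.volume 0 T := fun t =>
      ((hkt i t).mul (hNx x i)).intervalIntegrable 0 T
    change dist (∫ s in (0 : ℝ)..T, k i t₀ s * N i s (x (projIcc 0 T hT s)))
      (∫ s in (0 : ℝ)..T, k i t s * N i s (x (projIcc 0 T hT s))) ≤ _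
    rw [dist_eq_norm, ← intervalIntegral.integral_sub (hint t₀) (hint t)]
    refine intervalIntegral.norm_integral_le_of_norm_le hT ?_
      ((((hkt i t₀).sub (hkt i t)).abs.mul continuous_const).intervalIntegrable 0 T)
    refine Eventually.of_forall fun s hs => ?_
    rw [← sub_mul, norm_mul]
    exact mul_le_mul_of_nonneg_left (hB' x hx i s (Ioc_subset_Icc_self hs)) (norm_nonneg _)
  have hcomp : IsCompact (closure (ι '' (Φ '' A))) := by
    refine BoundedContinuousFunction.arzela_ascoli (Metric.closedBall 0 (|M| * |B| * |T - 0|))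
      (isCompact_closedBall _ _) _ ?_ hequi
    rintro _ t ⟨_, ⟨x, hx, rfl⟩, rfl⟩
    rw [mem_closedBall_zero_iff]
    exact hbound x hx t
  refine ι.toHomeomorph.isCompact_image.1 ?_
  rw [ι.toHomeomorph.image_closure]
  exact hcomp

end Hammerstein

/-! ### Annuli in the nonnegative orthant -/

section Annulus

variable {n : ℕ}

theorem continuous_sumNorm : Continuous (sumNorm (n := n)) :=
  continuous_finsetSum _ fun i _ => (continuous_apply i).abs

theorem sumNorm_of_nonneg {v : Fin n → ℝ} (hv : ∀ i, 0 ≤ v i) : sumNorm v = ∑ i, v i :=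
  Finset.sum_congr rfl fun i _ => abs_of_nonneg (hv i)

theorem abs_apply_le_sumNorm (v : Fin n → ℝ) (i : Fin n) : |v i| ≤ sumNorm v :=
  Finset.single_le_sum (f := fun i => |v i|) (fun _ _ => abs_nonneg _) (Finset.mem_univ i)

/-- The annulus `p ≤ |v| ≤ q` in the nonnegative orthant. -/
def orthantAnnulus (n : ℕ) (p q : ℝ) : Set (Fin n → ℝ) :=
  {v | (∀ i, 0 ≤ v i) ∧ sumNorm v ∈ Icc p q}

theorem isClosed_orthantAnnulus (p q : ℝ) : IsClosed (orthantAnnulus n p q) := by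
  have h : orthantAnnulus n p q = (⋂ i, {v | 0 ≤ v i}) ∩ sumNorm ⁻¹' Icc p q := by
    ext v; simp [orthantAnnulus]
  rw [h]
  exact (isClosed_iInter fun i => isClosed_le continuous_const (continuous_apply i)).inter
    (isClosed_Icc.preimage continuous_sumNorm)

theorem isCompact_orthantAnnulus (p q : ℝ) : IsCompact (orthantAnnulus n p q) := by
  refine (isCompact_closedBall (0 : Fin n → ℝ) |q|).of_isClosed_subset
    (isClosed_orthantAnnulus p q) fun v hv => ?_
  rw [mem_closedBall_zero_iff, pi_norm_le_iff_of_nonneg (abs_nonneg q)]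
  exact fun i => (abs_apply_le_sumNorm v i).trans (hv.2.2.trans (le_abs_self q))

theorem orthantAnnulus_subset {p : ℝ} (hp : 0 < p) (q : ℝ) :
    orthantAnnulus n p q ⊆ puncturedOrthant n := fun _ hv => ⟨hv.1, hp.trans_le hv.2.1⟩

theorem orthantAnnulus_mono {p q p' q' : ℝ} (hp : p' ≤ p) (hq : q ≤ q') :
    orthantAnnulus n p q ⊆ orthantAnnulus n p' q' :=
  fun _ hv => ⟨hv.1, hp.trans hv.2.1, hv.2.2.trans hq⟩

end Annulus

/-! ### Growth of the nonlinearities on small and large annuli -/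

section Bounds

variable {n : ℕ}

/-- Some `f_i` is so large on the annulus of values of those functions in `periodicCone n hT m M`
whose components have sum `ρ` at time `0`, that the integral operator raises that sum above `ρ`.
Here `m` and `M` are a lower and an upper bound for the Green functions. -/
def LowerBoundAt (T : ℝ) (g : Fin n → ℝ → ℝ) (f : Fin n → (Fin n → ℝ) → ℝ) (m M lam ρ : ℝ) :
    Prop :=
  ∃ i b, (∀ v ∈ orthantAnnulus n (m / M * ρ) (M / m * ρ), b ≤ f i v) ∧
    ρ < m * (lam * b * ∫ t in (0 : ℝ)..T, g i t)

/-- All `f_i` are so small on the annulus of values of those functions in `periodicCone n hT m M`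
whose components have sum `ρ` at time `0`, that the integral operator brings that sum below `ρ`. -/
def UpperBoundAt (T : ℝ) (g e : Fin n → ℝ → ℝ) (f : Fin n → (Fin n → ℝ) → ℝ) (m M lam ρ : ℝ) :
    Prop :=
  ∃ b, (∀ i, ∀ v ∈ orthantAnnulus n (m / M * ρ) (M / m * ρ), f i v ≤ b) ∧
    M * ∑ i, (lam * b * (∫ t in (0 : ℝ)..T, g i t) + lam * ∫ t in (0 : ℝ)..T, e i t) < ρ

variable {T : ℝ} {g e : Fin n → ℝ → ℝ} {f : Fin n → (Fin n → ℝ) → ℝ} {m M : ℝ}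

theorem eventually_lowerBoundAt_nhdsGT_zero (hn : 1 ≤ n) (hm : 0 < m) (hM : 0 < M)
    (hgint : ∀ i, 0 < ∫ t in (0 : ℝ)..T, g i t) (hf0 : ∀ i, Tendsto (f i) (orthantZero n) atTop)
    {lam : ℝ} (hlam : 0 < lam) : ∀ᶠ ρ in 𝓝[>] (0 : ℝ), LowerBoundAt T g f m M lam ρ := by
  let i : Fin n := ⟨0, hn⟩
  have h1 := (hf0 i).eventually_ge_atTop 1
  rw [orthantZero, eventually_nhdsWithin_iff, Metric.eventually_nhds_iff] at h1
  obtain ⟨ε, hε, h1⟩ := h1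
  have hc : 0 < m * (lam * 1 * ∫ t in (0 : ℝ)..T, g i t) :=
    mul_pos hm (mul_pos (by positivity) (hgint i))
  have hε' : 0 < ε / (M / m) := by positivity
  filter_upwards [self_mem_nhdsWithin, mem_nhdsWithin_of_mem_nhds (Iio_mem_nhds hc),
    mem_nhdsWithin_of_mem_nhds (Iio_mem_nhds hε')] with ρ hρ hρc hρε
  have hρ0 : 0 < ρ := hρ
  refine ⟨i, 1, fun v hv => h1 ?_ (orthantAnnulus_subset (by positivity) _ hv), hρc⟩
  rw [dist_zero_right, pi_norm_lt_iff hε]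
  intro j
  have h2 : M / m * ρ < ε := by
    rw [mul_comm]; exact (lt_div_iff₀ (by positivity)).1 hρε
  exact ((abs_apply_le_sumNorm v j).trans hv.2.2).trans_lt h2

theorem eventually_upperBoundAt_nhdsGT_zero (hm : 0 < m) (hM : 0 < M)
    (hfcont : ∀ i, ContinuousOn (f i) (puncturedOrthant n)) {ρ : ℝ} (hρ : 0 < ρ) :
    ∀ᶠ lam in 𝓝[>] (0 : ℝ), UpperBoundAt T g e f m M lam ρ := by
  have hQ := orthantAnnulus_subset (n := n) (p := m / M * ρ) (by positivity) (M / m * ρ)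
  choose B hB using fun i => (isCompact_orthantAnnulus (m / M * ρ)
    (M / m * ρ)).exists_bound_of_continuousOn ((hfcont i).mono hQ)
  let b := ∑ i, |B i|
  have hb : ∀ i, ∀ v ∈ orthantAnnulus n (m / M * ρ) (M / m * ρ), f i v ≤ b := fun i v hv =>
    (le_abs_self _).trans ((hB i v hv).trans ((le_abs_self _).trans
      (Finset.single_le_sum (f := fun i => |B i|) (fun _ _ => abs_nonneg _) (Finset.mem_univ i))))
  have hc : Tendsto (fun lam : ℝ => M * ∑ i, (lam * b * (∫ t in (0 : ℝ)..T, g i t) +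
      lam * ∫ t in (0 : ℝ)..T, e i t)) (𝓝[>] 0) (𝓝 0) := by
    have : Continuous (fun lam : ℝ => M * ∑ i, (lam * b * (∫ t in (0 : ℝ)..T, g i t) +
      lam * ∫ t in (0 : ℝ)..T, e i t)) := by fun_prop
    have h := this.tendsto 0
    simp only [zero_mul, add_zero, Finset.sum_const_zero, mul_zero] at h
    exact h.mono_left nhdsWithin_le_nhds
  filter_upwards [hc.eventually (gt_mem_nhds hρ)] with lam hl using ⟨b, hb, hl⟩

theorem exists_forall_of_eventually_orthantInfty {P : (Fin n → ℝ) → Prop}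
    (h : ∀ᶠ v in orthantInfty n, P v) : ∃ S : ℝ, ∀ v ∈ puncturedOrthant n, S ≤ sumNorm v → P v := by
  rw [orthantInfty, eventually_inf_principal, eventually_comap] at h
  obtain ⟨S, hS⟩ := eventually_atTop.1 h
  exact ⟨S, fun v hv hSv => hS _ hSv v rfl hv⟩

theorem eventually_lowerBoundAt_atTop (hn : 1 ≤ n) (hm : 0 < m) (hM : 0 < M)
    (hgint : ∀ i, 0 < ∫ t in (0 : ℝ)..T, g i t)
    (hf : ∀ i, Tendsto (fun x => f i x / sumNorm x) (orthantInfty n) atTop)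
    {lam : ℝ} (hlam : 0 < lam) : ∀ᶠ ρ in atTop, LowerBoundAt T g f m M lam ρ := by
  let i : Fin n := ⟨0, hn⟩
  set I := ∫ t in (0 : ℝ)..T, g i t with hI
  have hI0 : 0 < I := hgint i
  -- with this slope, the integral operator doubles the level `ρ`
  set c := 2 * M / (m * m * lam * I) with hc
  have hc0 : 0 < c := by positivity
  obtain ⟨S, hS⟩ := exists_forall_of_eventually_orthantInfty ((hf i).eventually_ge_atTop c)
  filter_upwards [eventually_gt_atTop 0, eventually_ge_atTop (M / m * S)] with ρ hρ hρS
  refine ⟨i, c * (m / M * ρ), fun v hv => ?_, ?_⟩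
  · have hvm := orthantAnnulus_subset (by positivity) _ hv
    have h1 : S ≤ sumNorm v := by
      refine le_trans ?_ hv.2.1
      calc S = m / M * (M / m * S) := by field_simp
        _ ≤ m / M * ρ := by gcongr
    exact (mul_le_mul_of_nonneg_left hv.2.1 hc0.le).trans ((le_div_iff₀ hvm.2).1 (hS v hvm h1))
  · have : m * (lam * (c * (m / M * ρ)) * I) = 2 * ρ := by
      rw [hc]; field_simp
    rw [← hI, this]
    linarith

theorem eventually_upperBoundAt_atTop (hm : 0 < m) (hM : 0 < M)
    (hgint : ∀ i, 0 < ∫ t in (0 : ℝ)..T, g i t)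
    (hf : ∀ i, Tendsto (fun x => f i x / sumNorm x) (orthantInfty n) (𝓝 0))
    {lam : ℝ} (hlam : 0 < lam) : ∀ᶠ ρ in atTop, UpperBoundAt T g e f m M lam ρ := by
  set I := ∑ i, ∫ t in (0 : ℝ)..T, g i t with hI
  set J := ∑ i, ∫ t in (0 : ℝ)..T, e i t with hJ
  have hI0 : 0 ≤ I := Finset.sum_nonneg fun i _ => (hgint i).le
  -- with this slope, the nonlinear terms contribute at most `ρ / 2`; `I + 1` keeps `c` positive
  -- without a separate argument for `0 < I`
  set c := m / (2 * M * M * lam * (I + 1)) with hc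
  have hc0 : 0 < c := by positivity
  have hev : ∀ᶠ v in orthantInfty n, ∀ i, f i v / sumNorm v ≤ c :=
    eventually_all.2 fun i => (hf i).eventually (ge_mem_nhds hc0)
  obtain ⟨S, hS⟩ := exists_forall_of_eventually_orthantInfty hev
  filter_upwards [eventually_gt_atTop 0, eventually_ge_atTop (M / m * S),
    eventually_gt_atTop (2 * (M * (lam * J)))] with ρ hρ hρS hρJ
  refine ⟨c * (M / m * ρ), fun i v hv => ?_, ?_⟩
  · have hvm := orthantAnnulus_subset (by positivity) _ hv
    have h1 : S ≤ sumNorm v := by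
      refine le_trans ?_ hv.2.1
      calc S = m / M * (M / m * S) := by field_simp
        _ ≤ m / M * ρ := by gcongr
    exact ((div_le_iff₀ hvm.2).1 (hS v hvm h1 i)).trans (mul_le_mul_of_nonneg_left hv.2.2 hc0.le)
  · rw [Finset.sum_add_distrib, ← Finset.mul_sum, ← Finset.mul_sum, ← hI, ← hJ]
    have h1 : M * (lam * (c * (M / m * ρ)) * I) = ρ / 2 * (I / (I + 1)) := by
      rw [hc]; field_simp
    have h2 : I / (I + 1) ≤ 1 := (div_le_one (by positivity)).2 (by linarith)
    rw [mul_add, h1]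
    nlinarith

end Bounds

/-! ### Solutions in a conical shell -/

section Existence

variable {n : ℕ}

theorem exists_continuous_eqOn_of_isClosed {Q : Set (Fin n → ℝ)} (hQ : IsClosed Q)
    {f : (Fin n → ℝ) → ℝ} (hf : ContinuousOn f Q) : ∃ F : (Fin n → ℝ) → ℝ, Continuous F ∧
      EqOn F f Q := by
  obtain ⟨F, hF⟩ := ContinuousMap.exists_restrict_eq hQ ⟨Q.domRestrict f, hf.domRestrict⟩
  exact ⟨F, F.continuous, fun v hv => DFunLike.congr_fun hF ⟨v, hv⟩⟩

theorem integral_kernel_mem_Icc {T m M : ℝ} (hT : 0 ≤ T) {k h : ℝ → ℝ} (hk : Continuous k)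
    (hh : Continuous h) (hkm : ∀ s ∈ Icc 0 T, m ≤ k s) (hkM : ∀ s ∈ Icc 0 T, k s ≤ M)
    (h0 : ∀ s ∈ Icc 0 T, 0 ≤ h s) :
    ∫ s in (0 : ℝ)..T, k s * h s ∈
      Icc (m * ∫ s in (0 : ℝ)..T, h s) (M * ∫ s in (0 : ℝ)..T, h s) := by
  rw [← intervalIntegral.integral_const_mul, ← intervalIntegral.integral_const_mul]
  exact ⟨intervalIntegral.integral_mono_on hT ((continuous_const.mul hh).intervalIntegrable 0 T)
      ((hk.mul hh).intervalIntegrable 0 T) fun s hs =>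
        mul_le_mul_of_nonneg_right (hkm s hs) (h0 s hs),
    intervalIntegral.integral_mono_on hT ((hk.mul hh).intervalIntegrable 0 T)
      ((continuous_const.mul hh).intervalIntegrable 0 T) fun s hs =>
        mul_le_mul_of_nonneg_right (hkM s hs) (h0 s hs)⟩

/-- The cone of nonnegative continuous functions on `[0, T]` with equal values at both ends whose
components satisfy the Harnack inequality `m x_i(s) ≤ M x_i(t)`. The integral operator maps into it
when the kernels take values in `[m, M]`. -/
def periodicCone (n : ℕ) {T : ℝ} (hT : 0 ≤ T) (m M : ℝ) : Set C(Icc (0 : ℝ) T, Fin n → ℝ) :=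
  {x | (∀ t i, 0 ≤ x t i) ∧ (∀ s t i, m * x s i ≤ M * x t i) ∧
    x ⟨0, left_mem_Icc.2 hT⟩ = x ⟨T, right_mem_Icc.2 hT⟩}

theorem isClosed_periodicCone {T : ℝ} (hT : 0 ≤ T) (m M : ℝ) :
    IsClosed (periodicCone n hT m M) := by
  have hev : ∀ t i, Continuous fun x : C(Icc (0 : ℝ) T, Fin n → ℝ) => x t i := fun t i =>
    (continuous_apply i).comp (continuous_eval_const t)
  have h : periodicCone n hT m M = (⋂ t, ⋂ i, {x | 0 ≤ x t i}) ∩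
      ((⋂ s, ⋂ t, ⋂ i, {x | m * x s i ≤ M * x t i}) ∩
        {x | x ⟨0, left_mem_Icc.2 hT⟩ = x ⟨T, right_mem_Icc.2 hT⟩}) := by
    ext x
    simp only [periodicCone, mem_inter_iff, mem_iInter, mem_ofPred_eq]
  rw [h]
  refine IsClosed.inter ?_ (IsClosed.inter ?_ ?_)
  · exact isClosed_iInter fun t => isClosed_iInter fun i => isClosed_le continuous_const (hev t i)
  · exact isClosed_iInter fun s => isClosed_iInter fun t => isClosed_iInter fun i =>
      isClosed_le (continuous_const.mul (hev s i)) (continuous_const.mul (hev t i))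
  · exact isClosed_eq (continuous_eval_const _) (continuous_eval_const _)

theorem smul_mem_periodicCone {T : ℝ} {hT : 0 ≤ T} {m M c : ℝ} (hc : 0 ≤ c)
    {x : C(Icc (0 : ℝ) T, Fin n → ℝ)} (hx : x ∈ periodicCone n hT m M) :
    c • x ∈ periodicCone n hT m M := by
  refine ⟨fun t i => mul_nonneg hc (hx.1 t i), fun s t i => ?_, ?_⟩
  · have := mul_le_mul_of_nonneg_left (hx.2.1 s t i) hc
    simp only [ContinuousMap.smul_apply, Pi.smul_apply, smul_eq_mul]
    linarith
  · simp only [ContinuousMap.smul_apply, hx.2.2]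

theorem convex_periodicCone {T : ℝ} (hT : 0 ≤ T) (m M : ℝ) :
    Convex ℝ (periodicCone n hT m M) := by
  intro x hx y hy p q hp hq _
  have hx' := smul_mem_periodicCone hp hx
  have hy' := smul_mem_periodicCone hq hy
  refine ⟨fun t i => add_nonneg (hx'.1 t i) (hy'.1 t i), fun s t i => ?_, ?_⟩
  · have := add_le_add (hx'.2.1 s t i) (hy'.2.1 s t i)
    simp only [ContinuousMap.add_apply, Pi.add_apply]
    linarith
  · simp only [ContinuousMap.add_apply, hx'.2.2, hy'.2.2]

/-- The functional `x ↦ ∑ i, x_i(0)`. On `periodicCone` it is comparable to the norm, and unlike the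
norm it is linear. -/
noncomputable def initialSum (n : ℕ) {T : ℝ} (hT : 0 ≤ T) :
    C(Icc (0 : ℝ) T, Fin n → ℝ) →L[ℝ] ℝ :=
  ∑ i, (ContinuousLinearMap.proj i).comp
    (ContinuousMap.evalCLM ℝ (⟨0, left_mem_Icc.2 hT⟩ : Icc (0 : ℝ) T))

theorem initialSum_apply {T : ℝ} (hT : 0 ≤ T) (x : C(Icc (0 : ℝ) T, Fin n → ℝ)) :
    initialSum n hT x = ∑ i, x ⟨0, left_mem_Icc.2 hT⟩ i := by
  simp [initialSum]

theorem apply_mem_orthantAnnulus {T : ℝ} {hT : 0 ≤ T} {m M : ℝ} (hm : 0 < m) (hM : 0 < M)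
    {x : C(Icc (0 : ℝ) T, Fin n → ℝ)} (hx : x ∈ periodicCone n hT m M) (t : Icc (0 : ℝ) T) :
    x t ∈ orthantAnnulus n (m / M * initialSum n hT x) (M / m * initialSum n hT x) := by
  refine ⟨hx.1 t, ?_⟩
  rw [sumNorm_of_nonneg (hx.1 t), initialSum_apply, div_mul_eq_mul_div, div_mul_eq_mul_div]
  refine ⟨(div_le_iff₀ hM).2 ?_, (le_div_iff₀ hm).2 ?_⟩ <;>
    rw [Finset.mul_sum, mul_comm, Finset.mul_sum] <;>
    exact Finset.sum_le_sum fun i _ => hx.2.1 _ _ i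

/-- The integral operator has a fixed point in a conical shell if it raises the level on one boundary
and lowers it on the other. The inequalities in the hypotheses are strict, so the solution lies
strictly between the two levels. -/
theorem exists_isPositivePeriodicSolution (hn : 1 ≤ n) {T : ℝ} (hT : 0 < T)
    {a g e : Fin n → ℝ → ℝ} {f : Fin n → (Fin n → ℝ) → ℝ} {G : Fin n → ℝ → ℝ → ℝ}
    (hG : ∀ i, IsGreenFunction T (a i) (G i))
    (hfcont : ∀ i, ContinuousOn (f i) (puncturedOrthant n))
    (hfpos : ∀ i, ∀ x ∈ puncturedOrthant n, 0 < f i x)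
    (ha : ∀ i, Continuous (a i)) (haT : ∀ i, Function.Periodic (a i) T)
    (hg : ∀ i, Continuous (g i)) (hgT : ∀ i, Function.Periodic (g i) T)
    (he : ∀ i, Continuous (e i)) (heT : ∀ i, Function.Periodic (e i) T)
    (hg0 : ∀ i, ∀ t ∈ Icc 0 T, 0 ≤ g i t)
    (hgint : ∀ i, 0 < ∫ t in (0 : ℝ)..T, g i t)
    (he0 : ∀ i, ∀ t ∈ Icc 0 T, 0 ≤ e i t)
    {m M : ℝ} (hm : 0 < m) (hM : 0 < M)
    (hGm : ∀ i, ∀ t ∈ Icc 0 T, ∀ s ∈ Icc 0 T, m ≤ G i t s)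
    (hGM : ∀ i, ∀ t ∈ Icc 0 T, ∀ s ∈ Icc 0 T, G i t s ≤ M)
    {lam r R : ℝ} (hlam : 0 < lam) (hr : 0 < r) (hrR : r ≤ R)
    (hbd : (LowerBoundAt T g f m M lam r ∧ UpperBoundAt T g e f m M lam R) ∨
      (UpperBoundAt T g e f m M lam r ∧ LowerBoundAt T g f m M lam R)) :
    ∃ x, IsPositivePeriodicSolution T a g e f lam x ∧ ∑ i, x 0 i ∈ Ioo r R := by
  have hT' := hT.le
  let Q := orthantAnnulus n (m / M * r) (M / m * R)
  have hQo : Q ⊆ puncturedOrthant n := orthantAnnulus_subset (by positivity) _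
  have hQc : IsCompact Q := isCompact_orthantAnnulus _ _
  -- only the values of `f_i` on `Q` matter; extending them continuously makes the operator total
  choose F hFc hFf using fun i => exists_continuous_eqOn_of_isClosed
    (isClosed_orthantAnnulus (m / M * r) (M / m * R)) ((hfcont i).mono hQo)
  -- `G_i` is controlled on the square only, so its arguments are projected there
  let k : Fin n → ℝ → ℝ → ℝ := fun i t s => G i (projIcc 0 T hT' t) (projIcc 0 T hT' s)
  have hk : ∀ i, Continuous (Function.uncurry (k i)) := fun i =>
    (hG i).continuousOn.comp_continuous
      ((continuous_subtype_val.comp ((continuous_projIcc (h := hT')).comp continuous_fst)).prodMk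
        (continuous_subtype_val.comp ((continuous_projIcc (h := hT')).comp continuous_snd)))
      fun z => ⟨(projIcc 0 T hT' z.1).2, (projIcc 0 T hT' z.2).2⟩
  have hkt : ∀ i t, Continuous (k i t) := fun i t =>
    (hk i).comp (continuous_const.prodMk continuous_id)
  let N : Fin n → ℝ → (Fin n → ℝ) → ℝ := fun i s v => lam * g i s * F i v + lam * e i s
  have hN : ∀ i, Continuous (Function.uncurry (N i)) := fun i =>
    ((continuous_const.mul ((hg i).comp continuous_fst)).mul ((hFc i).comp continuous_snd)).add
      (continuous_const.mul ((he i).comp continuous_fst))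
  let Φ := hammerstein hT' k hk N hN
  let α := initialSum n hT'
  let C := periodicCone n hT' m M
  let h : C(Icc (0 : ℝ) T, Fin n → ℝ) → Fin n → ℝ → ℝ := fun x i s =>
    N i s (x (projIcc 0 T hT' s))
  have hhc : ∀ x i, Continuous (h x i) := fun x i =>
    (hN i).comp (continuous_id.prodMk (x.continuous.comp continuous_projIcc))
  let I : C(Icc (0 : ℝ) T, Fin n → ℝ) → Fin n → ℝ := fun x i => ∫ s in (0 : ℝ)..T, h x i s
  have hxQ' : ∀ x ∈ C, ∀ t, x t ∈ orthantAnnulus n (m / M * α x) (M / m * α x) :=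
    fun x hx t => apply_mem_orthantAnnulus hm hM hx t
  have hxQ : ∀ x ∈ C, α x ∈ Icc r R → ∀ t, x t ∈ Q := fun x hx hα t =>
    orthantAnnulus_mono (by gcongr; exact hα.1) (by gcongr; exact hα.2) (hxQ' x hx t)
  have hh0 : ∀ x ∈ C, α x ∈ Icc r R → ∀ i, ∀ s ∈ Icc 0 T, 0 ≤ h x i s := by
    intro x hx hα i s hs
    have hq := hxQ x hx hα (projIcc 0 T hT' s)
    have h1 : 0 < F i (x (projIcc 0 T hT' s)) := by
      rw [hFf i hq]; exact hfpos i _ (hQo hq)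
    have h2 := hg0 i s hs
    have h3 := he0 i s hs
    simp only [h, N]
    positivity
  have hΦI : ∀ x ∈ C, α x ∈ Icc r R → ∀ t i, Φ x t i ∈ Icc (m * I x i) (M * I x i) :=
    fun x hx hα t i => integral_kernel_mem_Icc hT' (hkt i t) (hhc x i)
      (fun s _ => hGm i _ (projIcc 0 T hT' t).2 _ (projIcc 0 T hT' s).2)
      (fun s _ => hGM i _ (projIcc 0 T hT' t).2 _ (projIcc 0 T hT' s).2)
      (hh0 x hx hα i)
  have hIlow : ∀ x ∈ C, α x ∈ Icc r R → ∀ i b, (∀ t, b ≤ f i (x t)) →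
      lam * b * ∫ t in (0 : ℝ)..T, g i t ≤ I x i := by
    intro x hx hα i b hb
    rw [← intervalIntegral.integral_const_mul]
    refine intervalIntegral.integral_mono_on hT'
      ((continuous_const.mul (hg i)).intervalIntegrable 0 T) ((hhc x i).intervalIntegrable 0 T)
      fun s hs => ?_
    have hq := hxQ x hx hα (projIcc 0 T hT' s)
    have h1 := mul_le_mul_of_nonneg_left (hb (projIcc 0 T hT' s))
      (mul_nonneg hlam.le (hg0 i s hs))
    have h2 := mul_nonneg hlam.le (he0 i s hs)
    simp only [h, N]
    rw [hFf i hq]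
    linarith
  have hIup : ∀ x ∈ C, α x ∈ Icc r R → ∀ i b, (∀ t, f i (x t) ≤ b) →
      I x i ≤ lam * b * (∫ t in (0 : ℝ)..T, g i t) + lam * ∫ t in (0 : ℝ)..T, e i t := by
    intro x hx hα i b hb
    have hgi : IntervalIntegrable (fun s => lam * b * g i s) MeasureTheory.volume 0 T :=
      (continuous_const.mul (hg i)).intervalIntegrable 0 T
    have hei : IntervalIntegrable (fun s => lam * e i s) MeasureTheory.volume 0 T :=
      (continuous_const.mul (he i)).intervalIntegrable 0 T
    rw [← intervalIntegral.integral_const_mul, ← intervalIntegral.integral_const_mul,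
      ← intervalIntegral.integral_add hgi hei]
    refine intervalIntegral.integral_mono_on hT' ((hhc x i).intervalIntegrable 0 T) (hgi.add hei)
      fun s hs => ?_
    have hq := hxQ x hx hα (projIcc 0 T hT' s)
    have h1 := mul_le_mul_of_nonneg_left (hb (projIcc 0 T hT' s))
      (mul_nonneg hlam.le (hg0 i s hs))
    simp only [h, N]
    rw [hFf i hq]
    linarith
  -- a uniform positive lower bound for all components of the image
  obtain ⟨β, hβ, hβf⟩ : ∃ β : ℝ, 0 < β ∧ ∀ i, ∀ v ∈ Q, β ≤ f i v := by
    choose c hc hcf using fun i => hQc.exists_forall_le' ((hfcont i).mono hQo)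
      (fun v hv => hfpos i v (hQo hv))
    obtain ⟨j, -, hj⟩ := Finset.exists_min_image Finset.univ c ⟨⟨0, hn⟩, Finset.mem_univ _⟩
    exact ⟨c j, hc j, fun i v hv => (hj i (Finset.mem_univ i)).trans (hcf i v hv)⟩
  have hΦpos : ∀ x ∈ C, α x ∈ Icc r R → ∀ t i,
      m * (lam * β * ∫ t in (0 : ℝ)..T, g i t) ≤ Φ x t i := fun x hx hα t i =>
    (mul_le_mul_of_nonneg_left (hIlow x hx hα i β fun t => hβf i _ (hxQ x hx hα t)) hm.le).trans
      (hΦI x hx hα t i).1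
  have hcpos : ∀ i, 0 < m * (lam * β * ∫ t in (0 : ℝ)..T, g i t) := fun i =>
    mul_pos hm (mul_pos (mul_pos hlam hβ) (hgint i))
  have hαle : ∀ x ∈ C, α x ∈ Icc r R → ∀ i, Φ x ⟨0, left_mem_Icc.2 hT'⟩ i ≤ α (Φ x) :=
    fun x hx hα i => by
      simp only [α, initialSum_apply]
      exact Finset.single_le_sum (f := fun i => Φ x ⟨0, left_mem_Icc.2 hT'⟩ i)
        (fun j _ => (hcpos j).le.trans (hΦpos x hx hα _ j)) (Finset.mem_univ i)
  have hlower : ∀ ρ ∈ Icc r R, LowerBoundAt T g f m M lam ρ → ∀ x ∈ C, α x = ρ →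
      ρ < α (Φ x) := by
    rintro _ hρ ⟨i, b, hb, hlt⟩ x hx rfl
    exact hlt.trans_le ((mul_le_mul_of_nonneg_left
      (hIlow x hx hρ i b fun t => hb _ (hxQ' x hx t)) hm.le).trans
        ((hΦI x hx hρ _ i).1.trans (hαle x hx hρ i)))
  have hupper : ∀ ρ ∈ Icc r R, UpperBoundAt T g e f m M lam ρ → ∀ x ∈ C, α x = ρ →
      α (Φ x) < ρ := by
    rintro _ hρ ⟨b, hb, hlt⟩ x hx rfl
    refine lt_of_le_of_lt ?_ hlt
    simp only [α, initialSum_apply]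
    rw [Finset.mul_sum]
    exact Finset.sum_le_sum fun i _ => (hΦI x hx hρ _ i).2.trans
      (mul_le_mul_of_nonneg_left (hIup x hx hρ i b fun t => hb i _ (hxQ' x hx t)) hM.le)
  -- periodic extension of an element of the cone
  have hext : ∀ x ∈ C, ∃ u : ℝ → Fin n → ℝ, Continuous u ∧ Function.Periodic u T ∧
      ∀ t ∈ Icc 0 T, u t = x (projIcc 0 T hT' t) := by
    intro x hx
    obtain ⟨u, hu, hux⟩ := exists_periodic_eqOn hT (fun t => x (projIcc 0 T hT' t))
      (by simpa using hx.2.2)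
    refine ⟨u, continuous_of_periodic_of_continuousOn hT hu ?_, hu, hux⟩
    exact (x.continuous.comp continuous_projIcc).continuousOn.congr hux
  have hkG : ∀ i, ∀ t ∈ Icc 0 T, ∀ w : ℝ → ℝ, (∫ s in (0 : ℝ)..T, k i t s * w s) =
      ∫ s in (0 : ℝ)..T, G i t s * w s := by
    intro i t ht w
    refine intervalIntegral.integral_congr fun s hs => ?_
    rw [uIcc_of_le hT'] at hs
    simp only [k, projIcc_of_mem hT' ht, projIcc_of_mem hT' hs]
  have hΦC : ∀ x ∈ C, α x ∈ Icc r R → Φ x ∈ C := by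
    intro x hx hα
    refine ⟨fun t i => (hcpos i).le.trans (hΦpos x hx hα t i), fun s t i => ?_, ?_⟩
    · have h1 := mul_le_mul_of_nonneg_left (hΦI x hx hα s i).2 hm.le
      have h2 := mul_le_mul_of_nonneg_left (hΦI x hx hα t i).1 hM.le
      linarith
    -- the image takes equal values at both ends, since it solves a periodic problem
    · obtain ⟨u, huc, huT, hux⟩ := hext x hx
      ext i
      obtain ⟨y, -, -, h0, -⟩ := (hG i).solves (fun s => N i s (u s))
        ((hN i).comp (continuous_id.prodMk huc))
        (fun s => by simp only [N, huT s, hgT i s, heT i s])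
      have hΦu : ∀ t : Icc (0 : ℝ) T, Φ x t i = ∫ s in (0 : ℝ)..T, G i t s * N i s (u s) := by
        intro t
        rw [← hkG i t t.2]
        refine intervalIntegral.integral_congr fun s hs => ?_
        rw [uIcc_of_le hT'] at hs
        simp only [hux s hs]
      rw [hΦu, hΦu]
      exact h0
  obtain ⟨B, hB⟩ : ∃ B, ∀ i, ∀ z ∈ Icc 0 T ×ˢ Q, ‖Function.uncurry (N i) z‖ ≤ B := by
    choose B hB using fun i => (isCompact_Icc.prod hQc).exists_bound_of_continuousOn
      (s := Icc (0 : ℝ) T ×ˢ Q) (hN i).continuousOn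
    exact ⟨∑ i, |B i|, fun i z hz => (hB i z hz).trans ((le_abs_self _).trans
      (Finset.single_le_sum (f := fun i => |B i|) (fun j _ => abs_nonneg _)
        (Finset.mem_univ i)))⟩
  have hcompact := isCompact_closure_image_hammerstein hT' hk hN
    (A := {x ∈ C | α x ∈ Icc r R}) (B := B) fun x hx i s hs =>
      hB i (s, _) ⟨hs, hxQ x hx.1 hx.2 _⟩
  have hne : ∃ x ∈ C, 0 < α x := by
    have hmM : m ≤ M := (hGm ⟨0, hn⟩ 0 ⟨le_rfl, hT'⟩ 0 ⟨le_rfl, hT'⟩).trans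
      (hGM ⟨0, hn⟩ 0 ⟨le_rfl, hT'⟩ 0 ⟨le_rfl, hT'⟩)
    refine ⟨ContinuousMap.const _ fun _ => 1, ⟨fun _ _ => zero_le_one, fun _ _ _ => ?_, rfl⟩, ?_⟩
    · simpa using hmM
    · simp only [α, initialSum_apply, ContinuousMap.const_apply]
      exact Finset.sum_pos (fun _ _ => one_pos) ⟨⟨0, hn⟩, Finset.mem_univ _⟩
  have hrm : r ∈ Icc r R := ⟨le_rfl, hrR⟩
  have hRm : R ∈ Icc r R := ⟨hrR, le_rfl⟩
  -- compression if the level rises at `r` and falls at `R`, expansion in the other case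
  obtain ⟨κ, hκ, hκr, hκR⟩ : ∃ κ : ℝ, κ ≠ 0 ∧ (∀ x ∈ C, α x = r → 0 < κ * (α (Φ x) - r)) ∧
      ∀ x ∈ C, α x = R → κ * (α (Φ x) - R) < 0 := by
    rcases hbd with ⟨hl, hu⟩ | ⟨hu, hl⟩
    · refine ⟨1, one_ne_zero, fun x hx hα => ?_, fun x hx hα => ?_⟩
      · linarith [hlower r hrm hl x hx hα]
      · linarith [hupper R hRm hu x hx hα]
    · refine ⟨-1, by norm_num, fun x hx hα => ?_, fun x hx hα => ?_⟩
      · linarith [hupper r hrm hu x hx hα]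
      · linarith [hlower R hRm hl x hx hα]
  obtain ⟨x, hxC, hxα, hfix⟩ := exists_fixedPoint_of_cone (convex_periodicCone hT' m M)
    (isClosed_periodicCone hT' m M) (fun c hc x hx => smul_mem_periodicCone hc.le hx) α hr hrR hne
    hcompact (f := Φ) (continuous_hammerstein hT' hk hN).continuousOn
    (fun x hx => hΦC x hx.1 hx.2) (fun x hx => subset_closure (mem_image_of_mem _ hx))
    (hcpos ⟨0, hn⟩)
    (fun x hx hα => (hΦpos x hx hα _ _).trans (hαle x hx hα ⟨0, hn⟩)) κ hκ
    (fun x hx hα => (hκr x hx hα).le) (fun x hx hα => (hκR x hx hα).le)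
  obtain ⟨u, huc, huT, hux⟩ := hext x hxC
  have hxpos : ∀ t i, 0 < x t i := fun t i => by
    rw [← hfix]; exact (hcpos i).trans_le (hΦpos x hxC hxα t i)
  refine ⟨u, isPositivePeriodicSolution_of_integral_eq hn hT hG hfcont ha haT hg hgT he heT huc huT
    (fun t i => ?_) (fun i t ht => ?_), ?_⟩
  · have h1 : u (toIcoMod hT 0 t) = u t := huT.sub_zsmul_eq _
    have h2 := toIcoMod_mem_Ico hT 0 t
    rw [zero_add] at h2
    rw [← h1, hux _ (Ico_subset_Icc_self h2)]
    exact hxpos _ i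
  · rw [hux t ht, projIcc_of_mem hT' ht]
    calc x ⟨t, ht⟩ i = Φ x ⟨t, ht⟩ i := by rw [hfix]
      _ = ∫ s in (0 : ℝ)..T, k i t s * h x i s := rfl
      _ = ∫ s in (0 : ℝ)..T, G i t s * h x i s := hkG i t ht _
      _ = _ := by
        refine intervalIntegral.integral_congr fun s hs => ?_
        rw [uIcc_of_le hT'] at hs
        simp only [h, N]
        rw [hFf i (hxQ x hxC hxα _), hux s hs]
  · have hα : ∑ i, u 0 i = α x := by
      simp only [α, initialSum_apply]
      rw [hux 0 ⟨le_rfl, hT'⟩, projIcc_of_mem hT' ⟨le_rfl, hT'⟩]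
    rw [hα]
    refine ⟨lt_of_le_of_ne hxα.1 fun hEq => ?_, lt_of_le_of_ne hxα.2 fun hEq => ?_⟩
    · have := hκr x hxC hEq.symm
      rw [hfix, ← hEq, sub_self, mul_zero] at this
      exact lt_irrefl _ this
    · have := hκR x hxC hEq
      rw [hfix, hEq, sub_self, mul_zero] at this
      exact lt_irrefl _ this

theorem exists_kernel_bounds (hn : 1 ≤ n) {T : ℝ} {G : Fin n → ℝ → ℝ → ℝ}
    (hG : ∀ i, ContinuousOn (fun p : ℝ × ℝ => G i p.1 p.2) (Icc 0 T ×ˢ Icc 0 T))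
    (hGpos : ∀ i, ∀ t ∈ Icc 0 T, ∀ s ∈ Icc 0 T, 0 < G i t s) :
    ∃ m M : ℝ, 0 < m ∧ 0 < M ∧ (∀ i, ∀ t ∈ Icc 0 T, ∀ s ∈ Icc 0 T, m ≤ G i t s) ∧
      ∀ i, ∀ t ∈ Icc 0 T, ∀ s ∈ Icc 0 T, G i t s ≤ M := by
  have hc : IsCompact (Icc (0 : ℝ) T ×ˢ Icc (0 : ℝ) T) := isCompact_Icc.prod isCompact_Icc
  choose c hc0 hcG using fun i => hc.exists_forall_le' (hG i) (a := 0)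
    fun z hz => hGpos i z.1 hz.1 z.2 hz.2
  choose d hd using fun i => hc.exists_bound_of_continuousOn (hG i)
  obtain ⟨j, -, hj⟩ := Finset.exists_min_image Finset.univ c ⟨⟨0, hn⟩, Finset.mem_univ _⟩
  refine ⟨c j, 1 + ∑ i, |d i|, hc0 j, by positivity,
    fun i t ht s hs => (hj i (Finset.mem_univ i)).trans (hcG i (t, s) ⟨ht, hs⟩),
    fun i t ht s hs => ?_⟩
  have h1 := Finset.single_le_sum (f := fun i => |d i|) (fun _ _ => abs_nonneg _)
    (Finset.mem_univ i)
  have h2 : G i t s ≤ d i := (le_abs_self _).trans (hd i (t, s) ⟨ht, hs⟩)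
  linarith [le_abs_self (d i)]

end Existence

theorem theorem2p1 {n : ℕ} (hn : 1 ≤ n) {T : ℝ} (hT : 0 < T)
    (a g e : Fin n → ℝ → ℝ) (f : Fin n → (Fin n → ℝ) → ℝ)
    (G : Fin n → ℝ → ℝ → ℝ)
    -- positive Green functions
    (hG : ∀ i, IsGreenFunction T (a i) (G i))
    (hGpos : ∀ i, ∀ t ∈ Icc 0 T, ∀ s ∈ Icc 0 T, 0 < G i t s)
    -- the nonlinearities
    (hfcont : ∀ i, ContinuousOn (f i) (puncturedOrthant n))
    (hfpos : ∀ i, ∀ x ∈ puncturedOrthant n, 0 < f i x)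
    -- the coefficients
    (ha : ∀ i, Continuous (a i)) (haT : ∀ i, Function.Periodic (a i) T)
    (hg : ∀ i, Continuous (g i)) (hgT : ∀ i, Function.Periodic (g i) T)
    (he : ∀ i, Continuous (e i)) (heT : ∀ i, Function.Periodic (e i) T)
    (ha0 : ∀ i, ∀ t ∈ Icc 0 T, 0 ≤ a i t)
    (hg0 : ∀ i, ∀ t ∈ Icc 0 T, 0 ≤ g i t)
    (hgint : ∀ i, 0 < ∫ t in (0 : ℝ)..T, g i t)
    -- nonnegative forcing and singularity at the origin
    (he0 : ∀ i, ∀ t ∈ Icc 0 T, 0 ≤ e i t)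
    (hf0 : ∀ i, Tendsto (f i) (orthantZero n) atTop) :
    ((∀ i, Tendsto (fun x => f i x / sumNorm x) (orthantInfty n) (𝓝 0)) →
      ∀ lam : ℝ, 0 < lam → ∃ x, IsPositivePeriodicSolution T a g e f lam x) ∧
    ((∀ i, Tendsto (fun x => f i x / sumNorm x) (orthantInfty n) atTop) →
      ∃ lam₀ : ℝ, 0 < lam₀ ∧ ∀ lam : ℝ, 0 < lam → lam < lam₀ →
        ∃ x y, x ≠ y ∧ IsPositivePeriodicSolution T a g e f lam x ∧
          IsPositivePeriodicSolution T a g e f lam y) ∧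
    (∃ lam₀ : ℝ, 0 < lam₀ ∧ ∀ lam : ℝ, 0 < lam → lam < lam₀ →
      ∃ x, IsPositivePeriodicSolution T a g e f lam x) := by
  obtain ⟨m, M, hm, hM, hGm, hGM⟩ :=
    exists_kernel_bounds hn (fun i => (hG i).continuousOn) hGpos
  have hex := fun {lam r R : ℝ} => exists_isPositivePeriodicSolution (lam := lam) (r := r) (R := R)
    hn hT hG hfcont hfpos ha haT hg hgT he heT hg0 hgint he0 hm hM hGm hGM
  have hsmall : ∀ {lam : ℝ}, 0 < lam → ∃ r, LowerBoundAt T g f m M lam r ∧ 0 < r ∧ r < 1 :=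
    fun hlam => ((eventually_lowerBoundAt_nhdsGT_zero hn hm hM hgint hf0 hlam).and
      (Ioo_mem_nhdsGT one_pos)).exists
  obtain ⟨lam₀, hlam₀, hupper⟩ := (nhdsGT_basis (0 : ℝ)).eventually_iff.1
    (eventually_upperBoundAt_nhdsGT_zero (T := T) (g := g) (e := e) hm hM hfcont one_pos)
  refine ⟨fun hf lam hlam => ?_, fun hf => ⟨lam₀, hlam₀, fun lam hlam hlt => ?_⟩,
    lam₀, hlam₀, fun lam hlam hlt => ?_⟩
  · obtain ⟨r, hrl, hr, hr1⟩ := hsmall hlam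
    obtain ⟨R, hRu, hR⟩ := ((eventually_upperBoundAt_atTop (e := e) hm hM hgint hf hlam).and
      (eventually_ge_atTop 1)).exists
    obtain ⟨x, hx, -⟩ := hex hlam hr (hr1.le.trans hR) (Or.inl ⟨hrl, hRu⟩)
    exact ⟨x, hx⟩
  · obtain ⟨r, hrl, hr, hr1⟩ := hsmall hlam
    obtain ⟨R, hRl, hR⟩ := ((eventually_lowerBoundAt_atTop hn hm hM hgint hf hlam).and
      (eventually_ge_atTop 1)).exists
    obtain ⟨x, hx, hx1⟩ := hex hlam hr hr1.le (Or.inl ⟨hrl, hupper ⟨hlam, hlt⟩⟩)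
    obtain ⟨y, hy, hy1⟩ := hex hlam one_pos hR (Or.inr ⟨hupper ⟨hlam, hlt⟩, hRl⟩)
    refine ⟨x, y, ?_, hx, hy⟩
    rintro rfl
    exact lt_asymm hx1.2 hy1.1
  · obtain ⟨r, hrl, hr, hr1⟩ := hsmall hlam
    obtain ⟨x, hx, -⟩ := hex hlam hr hr1.le (Or.inl ⟨hrl, hupper ⟨hlam, hlt⟩⟩)
    exact ⟨x, hx⟩
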